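/- Let $M$ be a Kähler manifold with metric $g$ and complex structure $J$, and let the circle $S^1$ act smoothly and freely on $M$, preserving $g$ and $J$. Let $X$ be the vector field generated by the action, and suppose that the action has a moment map, i.e. a smooth function $\mu\colon M\to\mathbf R$ with $d\mu=\omega(X,\cdot)$, where $\omega(u,v)=g(Ju,v)$. The Kähler quotient of $M$ is the manifold $\mu^{-1}(0)/S^1$ with its induced metric: $\mu^{-1}(0)$ is an embedded submanifold of $M$, the projection $\pi\colon\mu^{-1}(0)\to\mu^{-1}(0)/S^1$ is a submersion, and $d\pi$ is isometric on the vectors tangent to $\mu^{-1}(0)$ and orthogonal to $X$. Let $N\subset M$ be an $S^1$-invariant embedded submanifold with the induced metric that is complex ($J$ preserves its tangent spaces) and totally geodesic (its second fundamental form vanishes), and let its Kähler quotient $(N\cap\mu^{-1}(0))/S^1$ be formed in the same way from the restricted action and the moment map $\mu|_N$. Then the natural map $(N\cap\mu^{-1}(0))/S^1\to\mu^{-1}(0)/S^1$ is a smooth isometric embedding whose image is totally geodesic, i.e. the Kähler quotient of $N$ is a totally geodesic submanifold of the Kähler quotient of $M$. -/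

import Mathlib

open Bundle Set Topology Manifold VectorField
open scoped Manifold ContDiff

noncomputable section

set_option linter.unusedSectionVars false
set_option linter.unusedSimpArgs false
set_option linter.style.haveILetI false

namespace KahlerQuot

section LeviCivita

variable {E : Type*} [NormedAddCommGroup E] [NormedSpace ℝ E] [FiniteDimensional ℝ E]
  {H : Type*} [TopologicalSpace H] (I : ModelWithCorners ℝ E H)
  {M : Type*} [TopologicalSpace M] [ChartedSpace H M] [IsManifold I ∞ M]
  [RiemannianBundle (fun x : M ↦ TangentSpace I x)]
  [IsContMDiffRiemannianBundle I ∞ E (fun x : M ↦ TangentSpace I x)]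

/-- The inner product of two vector fields, as a function on the manifold. -/
def ip (X Y : Π x : M, TangentSpace I x) (x : M) : ℝ := inner ℝ (X x) (Y x)

/-- The right hand side of the Koszul formula for `2 ⟨∇_X Y, Z⟩`. -/
def koszul (Y X Z : Π x : M, TangentSpace I x) (x : M) : ℝ :=
  d% (ip I Y Z) x (X x) + d% (ip I X Z) x (Y x) - d% (ip I X Y) x (Z x)
    + inner ℝ (mlieBracket I X Y x) (Z x) - inner ℝ (mlieBracket I X Z x) (Y x)
    - inner ℝ (mlieBracket I Y Z x) (X x)

variable {I}

variable {X X' Y Y' Z Z' : Π x : M, TangentSpace I x} {f : M → ℝ} {x : M}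

lemma ip_mdiff (hX : MDiffAt (T% X) x) (hY : MDiffAt (T% Y) x) : MDiffAt (ip I X Y) x :=
  MDifferentiableAt.inner_bundle (E := fun x : M ↦ TangentSpace I x) hX hY

lemma d_ip_add (hX : MDiffAt (T% X) x) (hX' : MDiffAt (T% X') x) (hY : MDiffAt (T% Y) x) :
    d% (ip I (X + X') Y) x = d% (ip I X Y) x + d% (ip I X' Y) x := by
  have : ip I (X + X') Y = ip I X Y + ip I X' Y := by
    ext y; simp [ip, inner_add_left]
  rw [this, mvfderiv_add (ip_mdiff hX hY) (ip_mdiff hX' hY)]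

lemma ip_comm (X Y : Π x : M, TangentSpace I x) : ip I X Y = ip I Y X := by
  ext y; simp [ip, real_inner_comm]

lemma d_ip_smul (hf : MDiffAt f x) (hX : MDiffAt (T% X) x) (hY : MDiffAt (T% Y) x) 
    (v : TangentSpace I x) :
    d% (ip I (f • X) Y) x v = f x * d% (ip I X Y) x v + inner ℝ (X x) (Y x) * d% f x v := by
  have : ip I (f • X) Y = f * ip I X Y := by
    ext y; simp [ip, inner_smul_left]
  rw [this, mvfderiv_mul hf (ip_mdiff hX hY)]
  simp [ip]

lemma koszul_tensorial_left (hY : MDiffAt (T% Y) x) (Z) (hZ : MDiffAt (T% Z) x) :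
    TensorialAt I E (koszul I Y · Z x) x where
  smul {f X} hf hX := by
    simp only [koszul, d_ip_smul hf hX hZ, d_ip_smul hf hX hY, mlieBracket_smul_left hf hX,
      Pi.smul_apply', map_smul, inner_add_left, inner_smul_left, inner_smul_right, smul_eq_mul,
      inner_neg_left, neg_smul]
    simp
    ring
  add {X X'} hX hX' := by
    simp only [koszul, d_ip_add hX hX' hZ, d_ip_add hX hX' hY, mlieBracket_add_left hX hX',
      Pi.add_apply, map_add, inner_add_left, inner_add_right]
    simp
    ring

lemma koszul_tensorial_right (hY : MDiffAt (T% Y) x) (X) (hX : MDiffAt (T% X) x) :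
    TensorialAt I E (koszul I Y X · x) x where
  smul {f Z} hf hZ := by
    simp only [koszul, ip_comm _ (f • Z), d_ip_smul hf hZ hX, d_ip_smul hf hZ hY,
      mlieBracket_smul_right hf hZ,
      Pi.smul_apply', map_smul, inner_add_left, inner_smul_left, inner_smul_right, smul_eq_mul,
      inner_neg_left, neg_smul]
    rw [ip_comm Z Y, ip_comm Z X]
    simp
    ring
  add {Z Z'} hZ hZ' := by
    simp only [koszul, ip_comm _ (Z + Z'), d_ip_add hZ hZ' hX, d_ip_add hZ hZ' hY,
      mlieBracket_add_right hZ hZ',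
      Pi.add_apply, map_add, inner_add_left, inner_add_right]
    simp [ip_comm Z, ip_comm Z']
    ring

/-- Raising an index: the vector `v` with `2 ⟨v, w⟩ = φ w` for all `w`. -/
def halfSharp (x : M) : (TangentSpace I x →L[ℝ] ℝ) →L[ℝ] TangentSpace I x :=
  have : FiniteDimensional ℝ (TangentSpace I x) := inferInstanceAs (FiniteDimensional ℝ E)
  have : CompleteSpace (TangentSpace I x) := FiniteDimensional.complete ℝ _
  LinearMap.toContinuousLinearMap
    { toFun φ := (1 / 2 : ℝ) • (InnerProductSpace.toDual ℝ (TangentSpace I x)).symm φ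
      map_add' φ ψ := by simp
      map_smul' c φ := by simp [smul_smul, mul_comm] }

lemma inner_halfSharp (x : M) (φ : TangentSpace I x →L[ℝ] ℝ) (w : TangentSpace I x) :
    inner ℝ (halfSharp x φ) w = φ w / 2 := by
  have : FiniteDimensional ℝ (TangentSpace I x) := inferInstanceAs (FiniteDimensional ℝ E)
  have : CompleteSpace (TangentSpace I x) := FiniteDimensional.complete ℝ _
  simp [halfSharp, inner_smul_left]
  ring

open Classical in
variable (I) in
/-- `leviCivitaFun I Y x v` is the vector `∇_v Y` at `x` that the Koszul formula defines if `Y` is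
differentiable at `x`, and `0` otherwise. -/
def leviCivitaFun (Y : Π x : M, TangentSpace I x) (x : M) :
    TangentSpace I x →L[ℝ] TangentSpace I x :=
  if hY : MDiffAt (T% Y) x then
    halfSharp x ∘L TensorialAt.mkHom₂ (koszul I Y · · x) x
      (koszul_tensorial_left hY) (koszul_tensorial_right hY)
  else 0

lemma inner_leviCivitaFun (hX : MDiffAt (T% X) x) (hY : MDiffAt (T% Y) x)
    (hZ : MDiffAt (T% Z) x) :
    inner ℝ (leviCivitaFun I Y x (X x)) (Z x) = koszul I Y X Z x / 2 := by
  simp only [leviCivitaFun, dif_pos hY]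
  rw [ContinuousLinearMap.comp_apply, inner_halfSharp,
    TensorialAt.mkHom₂_apply (koszul_tensorial_left hY) (koszul_tensorial_right hY) hX hZ]

lemma ext_inner_sections {A B : TangentSpace I x →L[ℝ] TangentSpace I x}
    (h : ∀ X Z : Π x : M, TangentSpace I x, MDiffAt (T% X) x → MDiffAt (T% Z) x →
      inner ℝ (A (X x)) (Z x) = inner ℝ (B (X x)) (Z x)) : A = B := by
  ext v
  refine ext_inner_right ℝ fun w ↦ ?_
  have := h (FiberBundle.extend E v) (FiberBundle.extend E w)
    (FiberBundle.mdifferentiableAt_extend ..) (FiberBundle.mdifferentiableAt_extend ..)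
  simpa using this

lemma isCovariantDerivativeOn_leviCivitaFun :
    IsCovariantDerivativeOn E (leviCivitaFun I (M := M)) where
  add {Y Y' x} hY hY' _ := by
    refine ext_inner_sections fun X Z hX hZ ↦ ?_
    rw [inner_leviCivitaFun hX (mdifferentiableAt_add_section hY hY') hZ,
      add_apply, inner_add_left, inner_leviCivitaFun hX hY hZ,
      inner_leviCivitaFun hX hY' hZ]
    simp only [koszul, d_ip_add hY hY' hZ, ip_comm X, d_ip_add hY hY' hX,
      mlieBracket_add_left hY hY', mlieBracket_add_right hY hY', 
      Pi.add_apply, map_add, inner_add_left, inner_add_right, add_apply]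
    ring
  leibniz {Y f x} hY hf _ := by
    refine ext_inner_sections fun X Z hX hZ ↦ ?_
    rw [inner_leviCivitaFun hX (hf.smul_section hY) hZ]
    simp only [add_apply, inner_add_left, smul_apply,
      ContinuousLinearMap.smulRight_apply, inner_smul_left, inner_leviCivitaFun hX hY hZ]
    simp only [koszul, d_ip_smul hf hY hZ, ip_comm X, d_ip_smul hf hY hX,
      mlieBracket_smul_left hf hY, mlieBracket_smul_right hf hY,
      Pi.smul_apply', map_smul, inner_add_left, inner_smul_left, inner_smul_right, smul_eq_mul,
      inner_neg_left, neg_smul]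
    simp
    ring

variable (I M) in
/-- The Levi-Civita connection of a Riemannian manifold, defined by the Koszul formula.
`leviCivita I M Y x v` is `∇_v Y` at `x`. -/
def leviCivita : CovariantDerivative I E (fun x : M ↦ TangentSpace I x) :=
  ⟨leviCivitaFun I, isCovariantDerivativeOn_leviCivitaFun⟩

theorem leviCivita_torsion : (leviCivita I M).torsion = 0 := by
  rw [CovariantDerivative.torsion_eq_zero_iff]
  intro X Y x hX hY
  refine ext_inner_right ℝ fun w ↦ ?_
  obtain ⟨Z, hZ, rfl⟩ : ∃ Z : Π x : M, TangentSpace I x, MDiffAt (T% Z) x ∧ Z x = w :=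
    ⟨FiberBundle.extend E w, FiberBundle.mdifferentiableAt_extend .., by simp⟩
  rw [inner_sub_left]
  change inner ℝ (leviCivitaFun I Y x (X x)) (Z x) - inner ℝ (leviCivitaFun I X x (Y x)) (Z x) = _
  rw [inner_leviCivitaFun hX hY hZ, inner_leviCivitaFun hY hX hZ]
  simp only [koszul, ip_comm Y X, mlieBracket_swap_apply (V := Y) (W := X), inner_neg_left]
  ring

theorem leviCivita_isMetricCompatible : 
    CovariantDerivative.IsMetricCompatible (V := fun x : M ↦ TangentSpace I x)
      (leviCivita I M) := by
  rw [CovariantDerivative.isMetricCompatible_iff]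
  intro x X Y Z hX hY hZ
  change d% (ip I Y Z) x (X x) = inner ℝ (leviCivitaFun I Y x (X x)) (Z x) +
    inner ℝ (Y x) (leviCivitaFun I Z x (X x))
  rw [real_inner_comm _ (Y x), inner_leviCivitaFun hX hY hZ, inner_leviCivitaFun hX hZ hY]
  simp only [koszul, ip_comm Z Y, mlieBracket_swap_apply (V := Z) (W := Y), inner_neg_left]
  ring

end LeviCivita
section TotallyGeodesic

variable {E : Type*} [NormedAddCommGroup E] [NormedSpace ℝ E]
  {M : Type*} [TopologicalSpace M] [ChartedSpace E M]
  {F : Type*} [NormedAddCommGroup F] [NormedSpace ℝ F]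
  {P : Type*} [TopologicalSpace P] [ChartedSpace F P]

/-- `f : P → M` pulls the Riemannian metric of `M` back to that of `P`. -/
def IsIsometric [RiemannianBundle (fun x : M ↦ TangentSpace 𝓘(ℝ, E) x)]
    [RiemannianBundle (fun p : P ↦ TangentSpace 𝓘(ℝ, F) p)] (f : P → M) : Prop :=
  ∀ (p : P) (v w : TangentSpace 𝓘(ℝ, F) p),
    inner ℝ (mfderiv 𝓘(ℝ, F) 𝓘(ℝ, E) f p v) (mfderiv 𝓘(ℝ, F) 𝓘(ℝ, E) f p w) = inner ℝ v w

/-- The immersion `f : P → M` is totally geodesic, i.e. its second fundamental form vanishes: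
for every vector field `Y` of `M` that is smooth near `f p` and tangent to `f` along `f` near `p`,
and every `v` tangent to `P` at `p`, the vector `∇_{df v} Y` is tangent to `f` at `p`. -/
def IsTotallyGeodesic [FiniteDimensional ℝ E] [IsManifold 𝓘(ℝ, E) ∞ M]
    [RiemannianBundle (fun x : M ↦ TangentSpace 𝓘(ℝ, E) x)]
    [IsContMDiffRiemannianBundle 𝓘(ℝ, E) ∞ E (fun x : M ↦ TangentSpace 𝓘(ℝ, E) x)]
    (f : P → M) : Prop :=
  ∀ (p : P) (Y : Π x : M, TangentSpace 𝓘(ℝ, E) x), CMDiffAt ∞ (T% Y) (f p) →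
    (∀ᶠ q in 𝓝 p, ∃ u : TangentSpace 𝓘(ℝ, F) q, mfderiv 𝓘(ℝ, F) 𝓘(ℝ, E) f q u = Y (f q)) →
    ∀ v : TangentSpace 𝓘(ℝ, F) p, ∃ w : TangentSpace 𝓘(ℝ, F) p,
      mfderiv 𝓘(ℝ, F) 𝓘(ℝ, E) f p w =
        leviCivita 𝓘(ℝ, E) M Y (f p) (mfderiv 𝓘(ℝ, F) 𝓘(ℝ, E) f p v)

end TotallyGeodesic

section Kahler

variable {E : Type*} [NormedAddCommGroup E] [NormedSpace ℝ E]
  {M : Type*} [TopologicalSpace M] [ChartedSpace E M]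

/-- `J` makes the Riemannian manifold `M` a Kähler manifold: it is a smooth orthogonal almost
complex structure that is parallel for the Levi-Civita connection. -/
structure IsKahler [FiniteDimensional ℝ E] [IsManifold 𝓘(ℝ, E) ∞ M]
    [RiemannianBundle (fun x : M ↦ TangentSpace 𝓘(ℝ, E) x)]
    [IsContMDiffRiemannianBundle 𝓘(ℝ, E) ∞ E (fun x : M ↦ TangentSpace 𝓘(ℝ, E) x)]
    (J : Π x : M, TangentSpace 𝓘(ℝ, E) x →L[ℝ] TangentSpace 𝓘(ℝ, E) x) : Prop where
  contMDiff : ContMDiff 𝓘(ℝ, E) (𝓘(ℝ, E).prod 𝓘(ℝ, E →L[ℝ] E)) ∞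
    (fun x ↦ TotalSpace.mk' (E →L[ℝ] E)
      (E := fun x : M ↦ TangentSpace 𝓘(ℝ, E) x →L[ℝ] TangentSpace 𝓘(ℝ, E) x) x (J x))
  sq (x : M) (v : TangentSpace 𝓘(ℝ, E) x) : J x (J x v) = -v
  orthogonal (x : M) (v w : TangentSpace 𝓘(ℝ, E) x) : inner ℝ (J x v) (J x w) = inner ℝ v w
  parallel (Y : Π x : M, TangentSpace 𝓘(ℝ, E) x) (x : M) (v : TangentSpace 𝓘(ℝ, E) x) :
    MDiffAt (T% Y) x →
      leviCivita 𝓘(ℝ, E) M (fun y ↦ J y (Y y)) x v = J x (leviCivita 𝓘(ℝ, E) M Y x v)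

variable [MulAction Circle M]

/-- The circle action preserves the metric and the complex structure `J`. -/
structure PreservesKahler [RiemannianBundle (fun x : M ↦ TangentSpace 𝓘(ℝ, E) x)]
    (J : Π x : M, TangentSpace 𝓘(ℝ, E) x →L[ℝ] TangentSpace 𝓘(ℝ, E) x) : Prop where
  metric (z : Circle) : IsIsometric (E := E) (F := E) (fun x : M ↦ z • x)
  complex (z : Circle) (x : M) (v : TangentSpace 𝓘(ℝ, E) x) :
    mfderiv 𝓘(ℝ, E) 𝓘(ℝ, E) (fun x : M ↦ z • x) x (J x v) =
      J (z • x) (mfderiv 𝓘(ℝ, E) 𝓘(ℝ, E) (fun x : M ↦ z • x) x v)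

variable (E) in
/-- The vector field generated by the circle action: `x ↦ d/dt (e ^ (i t) • x)` at `t = 0`. -/
def generator (x : M) : TangentSpace 𝓘(ℝ, E) x :=
  mfderiv 𝓘(ℝ, ℝ) 𝓘(ℝ, E) (fun t : ℝ ↦ Circle.exp t • x) 0 (1 : ℝ)

/-- `μ` is a moment map: `dμ = ω(X, ·)` with `X` the generator of the action and
`ω(u, v) = ⟨J u, v⟩` the Kähler form. -/
structure IsMomentMap [RiemannianBundle (fun x : M ↦ TangentSpace 𝓘(ℝ, E) x)]
    (J : Π x : M, TangentSpace 𝓘(ℝ, E) x →L[ℝ] TangentSpace 𝓘(ℝ, E) x) (μ : M → ℝ) : Prop where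
  contMDiff : CMDiff ∞ μ
  deriv (x : M) (v : TangentSpace 𝓘(ℝ, E) x) : d% μ x v = inner ℝ (J x (generator E x)) v

end Kahler

section Quotient

variable {M : Type*} [MulAction Circle M]

/-- The zero set `μ⁻¹(0)`. -/
abbrev ZeroLevel (μ : M → ℝ) : Type _ := {x : M // μ x = 0}

/-- Two points of `μ⁻¹(0)` are equivalent when they lie on the same orbit of the circle. -/
def orbitSetoid (μ : M → ℝ) : Setoid (ZeroLevel μ) where
  r a b := ∃ z : Circle, z • a.1 = b.1
  iseqv :=
    { refl := fun a ↦ ⟨1, one_smul _ _⟩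
      symm := fun ⟨z, hz⟩ ↦ ⟨z⁻¹, by rw [← hz, inv_smul_smul]⟩
      trans := fun ⟨z, hz⟩ ⟨z', hz'⟩ ↦ ⟨z' * z, by rw [mul_smul, hz, hz']⟩ }

/-- The orbit space `μ⁻¹(0) / S¹`. -/
def OrbitSpace (μ : M → ℝ) : Type _ := Quotient (orbitSetoid μ)

instance [TopologicalSpace M] (μ : M → ℝ) : TopologicalSpace (OrbitSpace μ) :=
  inferInstanceAs (TopologicalSpace (Quotient (orbitSetoid μ)))

/-- The projection `μ⁻¹(0) → μ⁻¹(0) / S¹`. -/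
def OrbitSpace.mk (μ : M → ℝ) (a : ZeroLevel μ) : OrbitSpace μ := Quotient.mk (orbitSetoid μ) a

/-- For an invariant subset `N` of `M`, the map `(N ∩ μ⁻¹(0)) / S¹ → μ⁻¹(0) / S¹` induced by the
inclusion. -/
def OrbitSpace.incl (N : SubMulAction Circle M) (μ : M → ℝ) :
    OrbitSpace (fun x : N ↦ μ x) → OrbitSpace μ :=
  Quotient.map (fun a ↦ (⟨a.1.1, a.2⟩ : ZeroLevel μ))
    (fun _ _ ⟨z, hz⟩ ↦ ⟨z, congrArg Subtype.val hz⟩)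

/-- The given smooth structures on `μ⁻¹(0)` and `μ⁻¹(0) / S¹` and the given Riemannian metric on
`μ⁻¹(0) / S¹` are those of the Kähler quotient: `μ⁻¹(0)` is an embedded submanifold of `M`, the
projection to the orbit space is a submersion, and it is isometric on the horizontal vectors, i.e.
on the vectors tangent to `μ⁻¹(0)` and orthogonal to the orbits. These conditions determine both
smooth structures and the metric. -/
structure IsKahlerQuotient
    {E : Type*} [NormedAddCommGroup E] [NormedSpace ℝ E] [TopologicalSpace M] [ChartedSpace E M]
    [RiemannianBundle (fun x : M ↦ TangentSpace 𝓘(ℝ, E) x)] (μ : M → ℝ)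
    {EZ : Type*} [NormedAddCommGroup EZ] [NormedSpace ℝ EZ] [ChartedSpace EZ (ZeroLevel μ)]
    {EQ : Type*} [NormedAddCommGroup EQ] [NormedSpace ℝ EQ] [ChartedSpace EQ (OrbitSpace μ)]
    [RiemannianBundle (fun q : OrbitSpace μ ↦ TangentSpace 𝓘(ℝ, EQ) q)] : Prop where
  isSmoothEmbedding :
    IsSmoothEmbedding 𝓘(ℝ, EZ) 𝓘(ℝ, E) ∞ (Subtype.val : ZeroLevel μ → M)
  isSubmersion : IsSubmersion 𝓘(ℝ, EZ) 𝓘(ℝ, EQ) ∞ (OrbitSpace.mk μ)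
  metric (a : ZeroLevel μ) (v w : TangentSpace 𝓘(ℝ, EZ) a) :
    inner ℝ (mfderiv 𝓘(ℝ, EZ) 𝓘(ℝ, E) (Subtype.val : ZeroLevel μ → M) a v)
      (generator E a.1) = 0 →
    inner ℝ (mfderiv 𝓘(ℝ, EZ) 𝓘(ℝ, E) (Subtype.val : ZeroLevel μ → M) a w)
      (generator E a.1) = 0 →
    inner ℝ (mfderiv 𝓘(ℝ, EZ) 𝓘(ℝ, EQ) (OrbitSpace.mk μ) a v)
        (mfderiv 𝓘(ℝ, EZ) 𝓘(ℝ, EQ) (OrbitSpace.mk μ) a w) =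
      inner ℝ (mfderiv 𝓘(ℝ, EZ) 𝓘(ℝ, E) (Subtype.val : ZeroLevel μ → M) a v)
        (mfderiv 𝓘(ℝ, EZ) 𝓘(ℝ, E) (Subtype.val : ZeroLevel μ → M) a w)

end Quotient

section Submanifold

variable {E : Type*} [NormedAddCommGroup E] [NormedSpace ℝ E] [FiniteDimensional ℝ E]
  {M : Type*} [TopologicalSpace M] [ChartedSpace E M] [IsManifold 𝓘(ℝ, E) ∞ M]
  [RiemannianBundle (fun x : M ↦ TangentSpace 𝓘(ℝ, E) x)]
  [IsContMDiffRiemannianBundle 𝓘(ℝ, E) ∞ E (fun x : M ↦ TangentSpace 𝓘(ℝ, E) x)]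
  [MulAction Circle M]

/-- The invariant subset `N` is an embedded submanifold of `M` with the induced metric, it is
complex (its tangent spaces are `J`-invariant), and it is totally geodesic. -/
structure IsComplexTotallyGeodesic
    (J : Π x : M, TangentSpace 𝓘(ℝ, E) x →L[ℝ] TangentSpace 𝓘(ℝ, E) x) (N : SubMulAction Circle M)
    {EN : Type*} [NormedAddCommGroup EN] [NormedSpace ℝ EN] [ChartedSpace EN N]
    [RiemannianBundle (fun x : N ↦ TangentSpace 𝓘(ℝ, EN) x)] : Prop where
  isSmoothEmbedding : IsSmoothEmbedding 𝓘(ℝ, EN) 𝓘(ℝ, E) ∞ (Subtype.val : N → M)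
  isIsometric : IsIsometric (E := E) (F := EN) (Subtype.val : N → M)
  complex (x : N) (v : TangentSpace 𝓘(ℝ, EN) x) : ∃ w : TangentSpace 𝓘(ℝ, EN) x,
    mfderiv 𝓘(ℝ, EN) 𝓘(ℝ, E) (Subtype.val : N → M) x w =
      J x.1 (mfderiv 𝓘(ℝ, EN) 𝓘(ℝ, E) (Subtype.val : N → M) x v)
  isTotallyGeodesic : IsTotallyGeodesic (E := E) (F := EN) (Subtype.val : N → M)

end Submanifold

end KahlerQuot

end

/-!
The natural map `ι` from the quotient of `N` to the quotient of `M` is covered by the inclusion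
`N ∩ μ⁻¹(0) → μ⁻¹(0)`. It is smooth because the projections are submersions and so have smooth local
sections (`Manifold.IsSubmersionAt.exists_section`). It is an embedding because the projections to
the orbit spaces are open. It is isometric because a vector that is horizontal in `N` is horizontal
in `M`.

For total geodesy, let `s` be a local section of `π : μ⁻¹(0) → μ⁻¹(0) / S¹` whose derivative at a
point `q` of the image of `ι` is the horizontal lift. The metric of the quotient is
`⟨ds u, ds v⟩ - ⟨ds u, X⟩ ⟨ds v, X⟩ / ⟨X, X⟩`, where `X` is the generator, and the correction term
vanishes to second order at `q`. Hence the metric of the quotient and the one that `s` induces have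
the same first derivatives at `q`. The Koszul formula involves only these and Lie brackets, which
are natural under related fields. Therefore `⟨∇_u Y, w⟩` on the quotient equals
`⟨∇_(ds u) Y', ds w⟩` on `M`, where `Y'` is any extension of `ds Y`
(`IsKahlerQuotient.exists_inner_leviCivita_eq`).

Let `Y` be tangent to the quotient of `N`, let `u` be tangent to it at `q`, and let `w` be
orthogonal to it. As `N` is invariant, `s` maps the quotient of `N` into `N`, so `Y'` is tangent to
`N` along the composite of `s` and `ι`. As `N` is totally geodesic, `∇_(ds u) Y'` is tangent to `N`
(`IsTotallyGeodesic.exists_mfderiv_eq_leviCivita_comp`). On the other hand `ds w` is orthogonal to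
`N` (`inner_mfderiv_val_eq_zero`). This is where `N` being complex is used: the tangent space of `N`
is spanned by `J X`, the gradient of `μ`, and by the tangent space of `N ∩ μ⁻¹(0)`. The vector
`ds w` is orthogonal to the first because it is tangent to `μ⁻¹(0)`. It is orthogonal to the second
because it is horizontal and `w` is orthogonal to the quotient of `N`. Hence `⟨∇_u Y, w⟩ = 0`, and
`∇_u Y` is tangent to the quotient of `N`.

The gradient of `μ` does not vanish because the action is free (`generator_ne_zero`).
-/

namespace KahlerQuot

set_option linter.unusedSectionVars false
set_option linter.unusedSimpArgs false
set_option linter.style.haveILetI false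

/-! ### Left inverses of immersions and sections of submersions -/

section NormalForm

variable {E : Type*} [NormedAddCommGroup E] [NormedSpace ℝ E]
  {M : Type*} [TopologicalSpace M] [ChartedSpace E M]
  {F : Type*} [NormedAddCommGroup F] [NormedSpace ℝ F]
  {P : Type*} [TopologicalSpace P] [ChartedSpace F P]
  {G : Type*} [NormedAddCommGroup G] [NormedSpace ℝ G]
  {R : Type*} [TopologicalSpace R] [ChartedSpace G R]

/-- An immersion has a smooth local left inverse: in the charts of the normal form it is the
inclusion of a factor, and the projection onto that factor is a left inverse. -/
theorem _root_.Manifold.IsImmersionAt.exists_leftInverse {f : P → M} {p : P}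
    (hf : IsImmersionAt 𝓘(ℝ, F) 𝓘(ℝ, E) ∞ f p) :
    ∃ (U : Set M) (ρ : M → P), IsOpen U ∧ f p ∈ U ∧ ContMDiffOn 𝓘(ℝ, E) 𝓘(ℝ, F) ∞ ρ U ∧
      ∀ᶠ q in 𝓝 p, ρ (f q) = q := by
  set φ := hf.domChart
  set ψ := hf.codChart
  set e := hf.equiv
  have key : ∀ q ∈ φ.source, ψ (f q) = e (φ q, 0) := by
    intro q hq
    have := hf.writtenInCharts
      (show φ q ∈ (φ.extend 𝓘(ℝ, F)).target by simpa using φ.map_source hq)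
    simpa [φ.left_inv hq, φ, ψ, e] using this
  have hπ : Continuous fun y ↦ (e.symm y).1 := continuous_fst.comp e.symm.continuous
  refine ⟨ψ.source ∩ ψ ⁻¹' ((fun y ↦ (e.symm y).1) ⁻¹' φ.target),
    fun m ↦ φ.symm (e.symm (ψ m)).1,
    ψ.isOpen_inter_preimage (φ.open_target.preimage hπ), ⟨hf.mem_codChart_source, ?_⟩, ?_, ?_⟩
  · change (e.symm (ψ (f p))).1 ∈ φ.target
    rw [key p hf.mem_domChart_source]
    simpa using φ.map_source hf.mem_domChart_source
  · have h1 := contMDiffOn_of_mem_maximalAtlas hf.codChart_mem_maximalAtlas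
    have h2 := contMDiffOn_symm_of_mem_maximalAtlas hf.domChart_mem_maximalAtlas
    have h3 : ContMDiff 𝓘(ℝ, E) 𝓘(ℝ, F) ∞ fun y ↦ (e.symm y).1 := by
      rw [contMDiff_iff_contDiff]; fun_prop
    exact h2.comp (h3.comp_contMDiffOn (h1.mono inter_subset_left)) fun m hm ↦ hm.2
  · filter_upwards [φ.open_source.mem_nhds hf.mem_domChart_source] with q hq
    rw [key q hq]
    simpa using φ.left_inv hq

theorem _root_.Manifold.IsSubmersionAt.codChart_apply {f : P → M} {p q : P}
    (hf : IsSubmersionAt 𝓘(ℝ, F) 𝓘(ℝ, E) ∞ f p) (hq : q ∈ hf.domChart.source) :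
    hf.codChart (f q) = (hf.equiv (hf.domChart q)).1 := by
  have := hf.writtenInCharts
    (show hf.domChart q ∈ (hf.domChart.extend 𝓘(ℝ, F)).target by
      simpa using hf.domChart.map_source hq)
  simpa [hf.domChart.left_inv hq] using this

theorem _root_.Manifold.IsSubmersionAt.mdifferentiable_domChart {f : P → M} {p : P}
    (hf : IsSubmersionAt 𝓘(ℝ, F) 𝓘(ℝ, E) ∞ f p) :
    hf.domChart.MDifferentiable 𝓘(ℝ, F) 𝓘(ℝ, F) :=
  ⟨(contMDiffOn_of_mem_maximalAtlas hf.domChart_mem_maximalAtlas).mdifferentiableOn (by simp),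
    (contMDiffOn_symm_of_mem_maximalAtlas hf.domChart_mem_maximalAtlas).mdifferentiableOn
      (by simp)⟩

theorem _root_.Manifold.IsSubmersionAt.mdifferentiable_codChart {f : P → M} {p : P}
    (hf : IsSubmersionAt 𝓘(ℝ, F) 𝓘(ℝ, E) ∞ f p) :
    hf.codChart.MDifferentiable 𝓘(ℝ, E) 𝓘(ℝ, E) :=
  ⟨(contMDiffOn_of_mem_maximalAtlas hf.codChart_mem_maximalAtlas).mdifferentiableOn (by simp),
    (contMDiffOn_symm_of_mem_maximalAtlas hf.codChart_mem_maximalAtlas).mdifferentiableOn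
      (by simp)⟩

/-- In the charts of the normal form a submersion is a linear projection, and so is its
derivative. -/
theorem _root_.Manifold.IsSubmersionAt.fst_equiv_mfderiv {f : P → M} {p : P}
    (hf : IsSubmersionAt 𝓘(ℝ, F) 𝓘(ℝ, E) ∞ f p) (v : TangentSpace 𝓘(ℝ, F) p) :
    (hf.equiv (mfderiv 𝓘(ℝ, F) 𝓘(ℝ, F) hf.domChart p v)).1 =
      mfderiv 𝓘(ℝ, E) 𝓘(ℝ, E) hf.codChart (f p) (mfderiv 𝓘(ℝ, F) 𝓘(ℝ, E) f p v) := by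
  have h1 : mfderiv 𝓘(ℝ, F) 𝓘(ℝ, E) (hf.codChart ∘ f) p =
      mfderiv 𝓘(ℝ, F) 𝓘(ℝ, E) ((fun y ↦ (hf.equiv y).1) ∘ hf.domChart) p := by
    apply Filter.EventuallyEq.mfderiv_eq
    filter_upwards [hf.domChart.open_source.mem_nhds hf.mem_domChart_source] with q hq
      using hf.codChart_apply hq
  have h2 : HasFDerivAt (fun y ↦ (hf.equiv y).1)
      (ContinuousLinearMap.fst ℝ E hf.complement ∘L (hf.equiv : F →L[ℝ] E × hf.complement))
      (hf.domChart p) :=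
    (ContinuousLinearMap.fst ℝ E hf.complement ∘L
      (hf.equiv : F →L[ℝ] E × hf.complement)).hasFDerivAt
  rw [mfderiv_comp p (hf.mdifferentiable_codChart.mdifferentiableAt hf.mem_codChart_source)
      (hf.contMDiffAt.mdifferentiableAt (by simp)),
    mfderiv_comp p h2.hasMFDerivAt.mdifferentiableAt
      (hf.mdifferentiable_domChart.mdifferentiableAt hf.mem_domChart_source),
    h2.hasMFDerivAt.mfderiv] at h1
  exact congr($h1 v).symm

theorem _root_.Manifold.IsSubmersionAt.mfderiv_surjective {f : P → M} {p : P}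
    (hf : IsSubmersionAt 𝓘(ℝ, F) 𝓘(ℝ, E) ∞ f p) :
    Function.Surjective (mfderiv 𝓘(ℝ, F) 𝓘(ℝ, E) f p) := by
  intro v
  let e := hf.equiv
  let A : F →L[ℝ] F := mfderiv 𝓘(ℝ, F) 𝓘(ℝ, F) hf.domChart p
  let B : E →L[ℝ] E := mfderiv 𝓘(ℝ, E) 𝓘(ℝ, E) hf.codChart (f p)
  obtain ⟨u, hu⟩ : ∃ u, A u = e.symm (B v, 0) :=
    hf.mdifferentiable_domChart.mfderiv_surjective hf.mem_domChart_source _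
  refine ⟨u, hf.mdifferentiable_codChart.mfderiv_injective hf.mem_codChart_source ?_⟩
  refine (hf.fst_equiv_mfderiv u).symm.trans ?_
  change (e (A u)).1 = B v
  simp [hu]

/-- A submersion has a smooth local section through every point, and the derivative of the section
at the base point can be prescribed to be any right inverse of the derivative. The section is
extended by the constant value `p` off its domain, so that all its values lie in the fibres over the
domain. -/
theorem _root_.Manifold.IsSubmersionAt.exists_section {f : P → M} {p : P}
    (hf : IsSubmersionAt 𝓘(ℝ, F) 𝓘(ℝ, E) ∞ f p)
    (h : TangentSpace 𝓘(ℝ, E) (f p) →L[ℝ] TangentSpace 𝓘(ℝ, F) p)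
    (hh : ∀ v, mfderiv 𝓘(ℝ, F) 𝓘(ℝ, E) f p (h v) = v) :
    ∃ (V : Set M) (s : M → P), IsOpen V ∧ f p ∈ V ∧ ContMDiffOn 𝓘(ℝ, E) 𝓘(ℝ, F) ∞ s V ∧
      s (f p) = p ∧ (∀ x ∈ V, f (s x) = x) ∧ (∀ x ∉ V, s x = p) ∧
      mfderiv 𝓘(ℝ, E) 𝓘(ℝ, F) s (f p) = h := by
  set φ := hf.domChart
  set ψ := hf.codChart
  set e := hf.equiv
  have hp : p ∈ φ.source := hf.mem_domChart_source
  have hfp : f p ∈ ψ.source := hf.mem_codChart_source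
  have hφ := contMDiffOn_of_mem_maximalAtlas hf.domChart_mem_maximalAtlas
  have hφ' := contMDiffOn_symm_of_mem_maximalAtlas hf.domChart_mem_maximalAtlas
  have hψ := contMDiffOn_of_mem_maximalAtlas hf.codChart_mem_maximalAtlas
  have hψ' := contMDiffOn_symm_of_mem_maximalAtlas hf.codChart_mem_maximalAtlas
  have hφd : φ.MDifferentiable 𝓘(ℝ, F) 𝓘(ℝ, F) := hf.mdifferentiable_domChart
  have hψd : ψ.MDifferentiable 𝓘(ℝ, E) 𝓘(ℝ, E) := hf.mdifferentiable_codChart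
  let A : F →L[ℝ] F := mfderiv 𝓘(ℝ, F) 𝓘(ℝ, F) φ p
  let A' : F →L[ℝ] F := mfderiv 𝓘(ℝ, F) 𝓘(ℝ, F) φ.symm (φ p)
  let B : E →L[ℝ] E := mfderiv 𝓘(ℝ, E) 𝓘(ℝ, E) ψ (f p)
  let B' : E →L[ℝ] E := mfderiv 𝓘(ℝ, E) 𝓘(ℝ, E) ψ.symm (ψ (f p))
  let h' : E →L[ℝ] F := h
  let K : E →L[ℝ] F := A ∘L h' ∘L B'
  have hA (v : F) : A' (A v) = v := congr($(hφd.symm_comp_deriv hp) v)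
  have hB (v : E) : B' (B v) = v := congr($(hψd.symm_comp_deriv hfp) v)
  have hB' (v : E) : B (B' v) = v := by
    have := hψd.comp_symm_deriv (ψ.map_source hfp)
    rw [ψ.left_inv hfp] at this
    exact congr($this v)
  -- in the charts `f` is the linear map `fst ∘ e`, which has `K` as a right inverse
  have hK (v : E) : (e (K v)).1 = v := by
    change (e (A (h' (B' v)))).1 = v
    exact (hf.fst_equiv_mfderiv _).trans <| (congrArg B (hh (B' v))).trans (hB' v)
  -- the section is affine in the charts, with linear part `K`
  let T : M → F := fun x ↦ φ p + K (ψ x - ψ (f p))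
  have hT : ContMDiffOn 𝓘(ℝ, E) 𝓘(ℝ, F) ∞ T ψ.source := by
    have : ContMDiff 𝓘(ℝ, E) 𝓘(ℝ, F) ∞ fun y : E ↦ φ p + K (y - ψ (f p)) := by
      rw [contMDiff_iff_contDiff]; fun_prop
    exact this.comp_contMDiffOn hψ
  have hTp : T (f p) = φ p := by simp [T]
  let V : Set M := ψ.source ∩ T ⁻¹' φ.target
  have hV : IsOpen V := hT.continuousOn.isOpen_inter_preimage ψ.open_source φ.open_target
  have hpV : f p ∈ V := ⟨hfp, by simpa [hTp] using φ.map_source hp⟩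
  classical
  let s : M → P := fun x ↦ if x ∈ V then φ.symm (T x) else p
  have hsV : EqOn s (φ.symm ∘ T) V := fun x hx ↦ if_pos hx
  refine ⟨V, s, hV, hpV, (hφ'.comp (hT.mono inter_subset_left) fun x hx ↦ hx.2).congr hsV,
    by simp [hsV hpV, hTp, φ.left_inv hp], ?_, fun x hx ↦ if_neg hx, ?_⟩
  · intro x hx
    rw [hsV hx]
    obtain ⟨hx, hx'⟩ := hx
    have hs : φ.symm (T x) ∈ φ.source := φ.map_target hx'
    refine ψ.injOn (hf.source_subset_preimage_source hs) hx ?_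
    refine (hf.codChart_apply hs).trans ?_
    change (e (φ (φ.symm (T x)))).1 = ψ x
    have : (e (φ p)).1 = ψ (f p) := (hf.codChart_apply hp).symm
    rw [φ.right_inv hx']
    simp [T, hK, this]
  · have h2 : HasFDerivAt (fun y : E ↦ φ p + K (y - ψ (f p))) K (ψ (f p)) :=
      (K.hasFDerivAt.comp _ ((hasFDerivAt_id _).sub_const _)).const_add _
    have hT' : HasMFDerivAt 𝓘(ℝ, E) 𝓘(ℝ, F) T (f p) (K ∘L B) :=
      h2.hasMFDerivAt.comp (f p) (hψd.mdifferentiableAt hfp).hasMFDerivAt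
    have hs : MDifferentiableAt 𝓘(ℝ, F) 𝓘(ℝ, F) φ.symm (T (f p)) := by
      rw [hTp]; exact hφd.symm.mdifferentiableAt (φ.map_source hp)
    rw [Filter.EventuallyEq.mfderiv_eq (hsV.eventuallyEq_of_mem (hV.mem_nhds hpV)),
      mfderiv_comp (f p) hs hT'.mdifferentiableAt, hT'.mfderiv, hTp]
    ext v
    change A' (A (h' (B' (B v)))) = h' v
    exact (hA _).trans (congrArg h' (hB v))

/-- An immersion that is also an embedding reflects continuous differentiability. -/
theorem _root_.Manifold.IsSmoothEmbedding.contMDiffAt_of_comp {f : P → M}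
    (hf : IsSmoothEmbedding 𝓘(ℝ, F) 𝓘(ℝ, E) ∞ f) {g : R → P} {r : R}
    (hg : ContMDiffAt 𝓘(ℝ, G) 𝓘(ℝ, E) ∞ (f ∘ g) r) : ContMDiffAt 𝓘(ℝ, G) 𝓘(ℝ, F) ∞ g r := by
  obtain ⟨U, ρ, hU, hfU, hρ, hρf⟩ := (hf.isImmersion.isImmersionAt (g r)).exists_leftInverse
  have hc : ContinuousAt g r := hf.isEmbedding.continuousAt_iff.2 hg.continuousAt
  exact ((hρ.contMDiffAt (hU.mem_nhds hfU)).comp r hg).congr_of_eventuallyEq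
    ((hc.eventually hρf).mono fun x hx ↦ hx.symm)

/-- An immersion that is also an embedding reflects differentiability. -/
theorem _root_.Manifold.IsSmoothEmbedding.mdifferentiableAt_of_comp {f : P → M}
    (hf : IsSmoothEmbedding 𝓘(ℝ, F) 𝓘(ℝ, E) ∞ f) {g : R → P} {r : R}
    (hg : MDifferentiableAt 𝓘(ℝ, G) 𝓘(ℝ, E) (f ∘ g) r) :
    MDifferentiableAt 𝓘(ℝ, G) 𝓘(ℝ, F) g r := by
  obtain ⟨U, ρ, hU, hfU, hρ, hρf⟩ := (hf.isImmersion.isImmersionAt (g r)).exists_leftInverse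
  have hc : ContinuousAt g r := hf.isEmbedding.continuousAt_iff.2 hg.continuousAt
  have hρd := (hρ.contMDiffAt (hU.mem_nhds hfU)).mdifferentiableAt (by simp)
  exact (hρd.comp r hg).congr_of_eventuallyEq ((hc.eventually hρf).mono fun x hx ↦ hx.symm)

end NormalForm

/-! ### Related vector fields and the Lie bracket -/

section Bracket

variable {E : Type*} [NormedAddCommGroup E] [NormedSpace ℝ E] [FiniteDimensional ℝ E]
  {M : Type*} [TopologicalSpace M] [ChartedSpace E M] [IsManifold 𝓘(ℝ, E) ∞ M]
  {F : Type*} [NormedAddCommGroup F] [NormedSpace ℝ F] [FiniteDimensional ℝ F]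
  {P : Type*} [TopologicalSpace P] [ChartedSpace F P] [IsManifold 𝓘(ℝ, F) ∞ P]

/-- The bracket of `f`-related vector fields on vector spaces is `f`-related: the two terms with the
second derivative of `f` cancel by its symmetry. -/
theorem lieBracket_of_related {f : F → E} {x : F} (hf : ContDiffAt ℝ 2 f x)
    {V W : F → F} {V' W' : E → E}
    (hV : DifferentiableAt ℝ V x) (hW : DifferentiableAt ℝ W x)
    (hV' : DifferentiableAt ℝ V' (f x)) (hW' : DifferentiableAt ℝ W' (f x))
    (hVV' : ∀ᶠ y in 𝓝 x, V' (f y) = fderiv ℝ f y (V y))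
    (hWW' : ∀ᶠ y in 𝓝 x, W' (f y) = fderiv ℝ f y (W y)) :
    lieBracket ℝ V' W' (f x) = fderiv ℝ f x (lieBracket ℝ V W x) := by
  have hfd : DifferentiableAt ℝ f x := hf.differentiableAt (by simp)
  have hf' : DifferentiableAt ℝ (fderiv ℝ f) x :=
    (hf.fderiv_right (m := 1) (by norm_num)).differentiableAt (by simp)
  have key {Z : F → F} {Z' : E → E} (hZ : DifferentiableAt ℝ Z x)
      (hZ' : DifferentiableAt ℝ Z' (f x)) (h : ∀ᶠ y in 𝓝 x, Z' (f y) = fderiv ℝ f y (Z y))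
      (u : F) : fderiv ℝ Z' (f x) (fderiv ℝ f x u) =
        fderiv ℝ (fderiv ℝ f) x u (Z x) + fderiv ℝ f x (fderiv ℝ Z x u) := by
    have h1 : HasFDerivAt (fun y ↦ Z' (f y)) _ x := hZ'.hasFDerivAt.comp x hfd.hasFDerivAt
    have h2 : HasFDerivAt (fun y ↦ fderiv ℝ f y (Z y)) _ x :=
      hf'.hasFDerivAt.clm_apply hZ.hasFDerivAt
    have := (h2.congr_of_eventuallyEq h).unique h1
    simpa [add_comm] using congr($this.symm u)
  have hsymm := (hf.isSymmSndFDerivAt (by simp)) (V x) (W x)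
  rw [lieBracket, lieBracket, hVV'.self_of_nhds, hWW'.self_of_nhds, key hW hW' hWW',
    key hV hV' hVV', hsymm, map_sub]
  abel

/-- The expression of a vector field in the preferred chart around `x`. -/
noncomputable def inChart (x : M) (V : Π x : M, TangentSpace 𝓘(ℝ, E) x) : E → E :=
  mpullback 𝓘(ℝ, E) 𝓘(ℝ, E) (extChartAt 𝓘(ℝ, E) x).symm V

omit [FiniteDimensional ℝ E] in
theorem isInvertible_mfderiv_extChartAt_symm (x : M) {y : E}
    (hy : y ∈ (extChartAt 𝓘(ℝ, E) x).target) :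
    (mfderiv 𝓘(ℝ, E) 𝓘(ℝ, E) (extChartAt 𝓘(ℝ, E) x).symm y).IsInvertible := by
  have : IsManifold 𝓘(ℝ, E) 1 M := .of_le (n := ∞) (by simp)
  simpa using isInvertible_mfderivWithin_extChartAt_symm hy

theorem mfderiv_extChartAt_symm_inChart (x : M) (V : Π x : M, TangentSpace 𝓘(ℝ, E) x) {y : E}
    (hy : y ∈ (extChartAt 𝓘(ℝ, E) x).target) :
    mfderiv 𝓘(ℝ, E) 𝓘(ℝ, E) (extChartAt 𝓘(ℝ, E) x).symm y (inChart (E := E) x V y) =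
      V ((extChartAt 𝓘(ℝ, E) x).symm y) := by
  exact congr($((isInvertible_mfderiv_extChartAt_symm x hy).self_comp_inverse) _)

theorem differentiableAt_inChart (x : M) {V : Π x : M, TangentSpace 𝓘(ℝ, E) x}
    (hV : MDiffAt (T% V) x) :
    DifferentiableAt ℝ (inChart x V) (extChartAt 𝓘(ℝ, E) x x) := by
  have : CompleteSpace E := FiniteDimensional.complete ℝ E
  have : IsManifold 𝓘(ℝ, E) 2 M := .of_le (n := ∞) (by norm_cast)
  have := MDifferentiableWithinAt.differentiableWithinAt_mpullbackWithin_vectorField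
    (mdifferentiableWithinAt_univ.2 hV)
  simp only [modelWithCornersSelf_coe, range_id, preimage_univ, inter_univ,
    mpullbackWithin_univ] at this
  exact differentiableWithinAt_univ.1 this

theorem mfderiv_extChartAt_mlieBracket (x : M) (V W : Π x : M, TangentSpace 𝓘(ℝ, E) x) :
    mfderiv 𝓘(ℝ, E) 𝓘(ℝ, E) (extChartAt 𝓘(ℝ, E) x) x (mlieBracket 𝓘(ℝ, E) V W x) =
      lieBracket ℝ (inChart x V) (inChart x W) (extChartAt 𝓘(ℝ, E) x x) := by
  have : IsManifold 𝓘(ℝ, E) 1 M := .of_le (n := ∞) (by simp)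
  rw [← mlieBracketWithin_univ, mlieBracketWithin_apply]
  simp only [modelWithCornersSelf_coe, range_id, preimage_univ, inter_univ,
    mpullbackWithin_univ]
  rw [← lieBracketWithin_univ]
  exact congr($((isInvertible_mfderiv_extChartAt (mem_extChartAt_source x)).self_comp_inverse) _)

/-- The Lie bracket of two pairs of `f`-related vector fields is again `f`-related. -/
theorem mlieBracket_of_related {f : P → M} {x : P} (hf : ContMDiffAt 𝓘(ℝ, F) 𝓘(ℝ, E) ∞ f x)
    {V W : Π x : P, TangentSpace 𝓘(ℝ, F) x} {V' W' : Π x : M, TangentSpace 𝓘(ℝ, E) x}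
    (hV : MDiffAt (T% V) x) (hW : MDiffAt (T% W) x)
    (hV' : MDiffAt (T% V') (f x)) (hW' : MDiffAt (T% W') (f x))
    (hVV' : ∀ᶠ y in 𝓝 x, V' (f y) = mfderiv 𝓘(ℝ, F) 𝓘(ℝ, E) f y (V y))
    (hWW' : ∀ᶠ y in 𝓝 x, W' (f y) = mfderiv 𝓘(ℝ, F) 𝓘(ℝ, E) f y (W y)) :
    mlieBracket 𝓘(ℝ, E) V' W' (f x) =
      mfderiv 𝓘(ℝ, F) 𝓘(ℝ, E) f x (mlieBracket 𝓘(ℝ, F) V W x) := by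
  have : IsManifold 𝓘(ℝ, E) 1 M := .of_le (n := ∞) (by simp)
  have : IsManifold 𝓘(ℝ, F) 1 P := .of_le (n := ∞) (by simp)
  set φ := extChartAt 𝓘(ℝ, F) x with hφ
  set ψ := extChartAt 𝓘(ℝ, E) (f x) with hψ
  let g : F → E := ψ ∘ f ∘ φ.symm
  have hx : φ.symm (φ x) = x := extChartAt_to_inv x
  have hxt : φ x ∈ φ.target := mem_extChartAt_target x
  have hg : ContDiffAt ℝ ∞ g (φ x) := by
    have := (contMDiffAt_iff.1 hf).2
    simpa only [modelWithCornersSelf_coe, range_id, contDiffWithinAt_univ] using this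
  have hgx : g (φ x) = ψ (f x) := by simp [g, hx]
  -- all the conditions that hold near `x`, at a point `y` of the chart
  have hnear : ∀ᶠ y in 𝓝 (φ x), y ∈ φ.target ∧ f (φ.symm y) ∈ ψ.source ∧
      MDifferentiableAt 𝓘(ℝ, F) 𝓘(ℝ, E) f (φ.symm y) := by
    have h1 : φ.target ∈ 𝓝 (φ x) := extChartAt_target_mem_nhds x
    have h2 : Filter.Tendsto φ.symm (𝓝 (φ x)) (𝓝 x) := by
      have := continuousAt_extChartAt_symm (I := 𝓘(ℝ, F)) x
      rwa [ContinuousAt, ← hφ, hx] at this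
    have h3 : ∀ᶠ z in 𝓝 x, f z ∈ ψ.source :=
      hf.continuousAt.eventually (extChartAt_source_mem_nhds (f x))
    have h4 : ∀ᶠ z in 𝓝 x, MDifferentiableAt 𝓘(ℝ, F) 𝓘(ℝ, E) f z := by
      have h5 : ContMDiffAt 𝓘(ℝ, F) 𝓘(ℝ, E) 1 f x := hf.of_le (by simp)
      filter_upwards [(contMDiffAt_iff_contMDiffAt_nhds (by simp)).1 h5] with z hz
        using hz.mdifferentiableAt (by simp)
    filter_upwards [h1, h2.eventually h3, h2.eventually h4] with y a b c using ⟨a, b, c⟩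
  have hgd : ∀ᶠ y in 𝓝 (φ x), DifferentiableAt ℝ g y := by
    have : ContDiffAt ℝ 1 g (φ x) := hg.of_le (by simp)
    filter_upwards [this.eventually (by simp)] with y hy using hy.differentiableAt (by simp)
  -- the expressions of related fields in the charts are related by the expression `g` of `f`
  have hrel {Z : Π x : P, TangentSpace 𝓘(ℝ, F) x} {Z' : Π x : M, TangentSpace 𝓘(ℝ, E) x}
      (h : ∀ᶠ y in 𝓝 x, Z' (f y) = mfderiv 𝓘(ℝ, F) 𝓘(ℝ, E) f y (Z y)) :
      ∀ᶠ y in 𝓝 (φ x), inChart (f x) Z' (g y) = fderiv ℝ g y (inChart x Z y) := by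
    have h2 : Filter.Tendsto φ.symm (𝓝 (φ x)) (𝓝 x) := by
      have := continuousAt_extChartAt_symm (I := 𝓘(ℝ, F)) x
      rwa [ContinuousAt, ← hφ, hx] at this
    filter_upwards [hnear.eventually_nhds, h2.eventually h, hgd] with y hy hyZ hyg
    obtain ⟨hy1, hy2, hy3⟩ := hy.self_of_nhds
    have hgy : g y ∈ ψ.target := ψ.map_source hy2
    have hψg : ψ.symm (g y) = f (φ.symm y) := ψ.left_inv hy2
    refine (isInvertible_mfderiv_extChartAt_symm (f x) hgy).injective ?_
    have h5 : mfderiv 𝓘(ℝ, F) 𝓘(ℝ, E) (ψ.symm ∘ g) y = mfderiv 𝓘(ℝ, F) 𝓘(ℝ, E) (f ∘ φ.symm) y :=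
      Filter.EventuallyEq.mfderiv_eq <| hy.mono fun z hz ↦ ψ.left_inv hz.2.1
    have h6 : MDifferentiableAt 𝓘(ℝ, F) 𝓘(ℝ, F) φ.symm y :=
      mdifferentiableAt_of_isInvertible_mfderiv (isInvertible_mfderiv_extChartAt_symm x hy1)
    have h7 : MDifferentiableAt 𝓘(ℝ, E) 𝓘(ℝ, E) ψ.symm (g y) :=
      mdifferentiableAt_of_isInvertible_mfderiv (isInvertible_mfderiv_extChartAt_symm (f x) hgy)
    rw [mfderiv_comp y h7 hyg.mdifferentiableAt, mfderiv_comp y hy3 h6] at h5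
    rw [mfderiv_extChartAt_symm_inChart (f x) Z' hgy]
    have h8 := congr($h5 (inChart (E := F) x Z y))
    rw [mfderiv_eq_fderiv] at h8
    refine Eq.trans ?_ h8.symm
    change Z' (ψ.symm (g y)) = mfderiv 𝓘(ℝ, F) 𝓘(ℝ, E) f (φ.symm y)
      (mfderiv 𝓘(ℝ, F) 𝓘(ℝ, F) φ.symm y (inChart (E := F) x Z y))
    rw [mfderiv_extChartAt_symm_inChart x Z hy1, ← hyZ, hψg]
  refine (isInvertible_mfderiv_extChartAt (mem_extChartAt_source (f x))).injective ?_
  rw [mfderiv_extChartAt_mlieBracket]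
  have hfd : MDifferentiableAt 𝓘(ℝ, F) 𝓘(ℝ, E) f x := hf.mdifferentiableAt (by simp)
  have hφd : MDifferentiableAt 𝓘(ℝ, F) 𝓘(ℝ, F) φ x :=
    mdifferentiableAt_extChartAt (mem_chart_source F x)
  have hψd : MDifferentiableAt 𝓘(ℝ, E) 𝓘(ℝ, E) ψ (f x) :=
    mdifferentiableAt_extChartAt (mem_chart_source E (f x))
  have h1 : mfderiv 𝓘(ℝ, F) 𝓘(ℝ, E) (ψ ∘ f) x = mfderiv 𝓘(ℝ, F) 𝓘(ℝ, E) (g ∘ φ) x := by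
    apply Filter.EventuallyEq.mfderiv_eq
    filter_upwards [extChartAt_source_mem_nhds (I := 𝓘(ℝ, F)) x] with z hz
    simp [g, φ.left_inv hz]
  rw [mfderiv_comp x hψd hfd,
    mfderiv_comp x (hg.differentiableAt (by simp)).mdifferentiableAt hφd] at h1
  have h2 := congr($h1 (mlieBracket 𝓘(ℝ, F) V W x))
  refine Eq.trans ?_ h2.symm
  change _ = mfderiv 𝓘(ℝ, F) 𝓘(ℝ, E) g (φ x)
    (mfderiv 𝓘(ℝ, F) 𝓘(ℝ, F) φ x (mlieBracket 𝓘(ℝ, F) V W x))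
  rw [mfderiv_extChartAt_mlieBracket, mfderiv_eq_fderiv]
  have h3 := lieBracket_of_related (hg.of_le (by norm_cast))
    (differentiableAt_inChart x hV) (differentiableAt_inChart x hW)
    (by rw [hgx]; exact differentiableAt_inChart (f x) hV')
    (by rw [hgx]; exact differentiableAt_inChart (f x) hW') (hrel hVV') (hrel hWW')
  rw [hgx] at h3
  exact h3

end Bracket

/-! ### Extension of vector fields given along a map -/

section RelatedFields

variable {E : Type*} [NormedAddCommGroup E] [NormedSpace ℝ E]
  {M : Type*} [TopologicalSpace M] [ChartedSpace E M] [IsManifold 𝓘(ℝ, E) ∞ M]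
  {F : Type*} [NormedAddCommGroup F] [NormedSpace ℝ F]
  {P : Type*} [TopologicalSpace P] [ChartedSpace F P] [IsManifold 𝓘(ℝ, F) ∞ P]

theorem tangentBundle_exists_eq_mk {X : TangentBundle 𝓘(ℝ, E) M} {x : M} (h : X.proj = x) :
    ∃ v : TangentSpace 𝓘(ℝ, E) x, X = ⟨x, v⟩ := by
  subst h; exact ⟨X.2, rfl⟩

theorem contMDiffAt_tangentMap {f : P → M} {U : Set P} (hU : IsOpen U)
    (hf : ContMDiffOn 𝓘(ℝ, F) 𝓘(ℝ, E) ∞ f U) {X : TangentBundle 𝓘(ℝ, F) P} (hX : X.proj ∈ U) :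
    ContMDiffAt 𝓘(ℝ, F).tangent 𝓘(ℝ, E).tangent ∞ (tangentMap 𝓘(ℝ, F) 𝓘(ℝ, E) f) X := by
  have : IsManifold 𝓘(ℝ, E) 1 M := .of_le (n := ∞) (by simp)
  have : IsManifold 𝓘(ℝ, F) 1 P := .of_le (n := ∞) (by simp)
  have h := hf.contMDiffOn_tangentMapWithin (m := ∞) (by simp) hU.uniqueMDiffOn
  have hU' : IsOpen (TotalSpace.proj ⁻¹' U : Set (TangentBundle 𝓘(ℝ, F) P)) :=
    hU.preimage (FiberBundle.continuous_proj F (TangentSpace 𝓘(ℝ, F)))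
  refine (h.contMDiffAt (hU'.mem_nhds hX)).congr_of_eventuallyEq ?_
  filter_upwards [hU'.mem_nhds hX] with Z hZ
  exact (tangentMapWithin_eq_tangentMap (hU.uniqueMDiffOn _ hZ)
    ((hf.contMDiffAt (hU.mem_nhds hZ)).mdifferentiableAt (by simp))).symm

/-- A smooth map `V : M → TM` coincides, at the points `m` where `V m` is based at `m`, with a
vector field that is smooth near the given point: the vectors are moved to the right fibre by a
local trivialization. -/
theorem exists_vectorField_eq {V : M → TangentBundle 𝓘(ℝ, E) M} {a : M}
    (hV : ContMDiffAt 𝓘(ℝ, E) 𝓘(ℝ, E).tangent ∞ V a) (ha : (V a).proj = a) :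
    ∃ Y : Π x : M, TangentSpace 𝓘(ℝ, E) x, CMDiffAt ∞ (T% Y) a ∧
      ∀ᶠ m in 𝓝 a, ∀ v : TangentSpace 𝓘(ℝ, E) m, V m = ⟨m, v⟩ → Y m = v := by
  let e := trivializationAt E (TangentSpace 𝓘(ℝ, E) : M → Type _) a
  have he : ∀ᶠ m in 𝓝 a, m ∈ e.baseSet :=
    e.open_baseSet.mem_nhds (FiberBundle.mem_baseSet_trivializationAt' a)
  refine ⟨fun m ↦ e.symm m (e (V m)).2, ?_, ?_⟩
  · rw [contMDiffAt_section]
    have h := (contMDiffAt_totalSpace.1 hV).2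
    rw [ha] at h
    refine h.congr_of_eventuallyEq ?_
    filter_upwards [he] with m hm
    change (e ⟨m, e.symm m (e (V m)).2⟩).2 = _
    rw [e.apply_mk_symm hm]
  · filter_upwards [he] with m hm v hv
    rw [hv, e.symm_apply_apply_mk hm]

/-- A vector field is `σ`-related to a vector field on the target if `σ` has a smooth local left
inverse `r`. -/
theorem exists_related_vectorField {σ : P → M} {r : M → P} {q : P} {U : Set P}
    (hU : IsOpen U) (hq : q ∈ U)
    (hσ : ContMDiffOn 𝓘(ℝ, F) 𝓘(ℝ, E) ∞ σ U)
    (hr : ContMDiffAt 𝓘(ℝ, E) 𝓘(ℝ, F) ∞ r (σ q)) (hrσ : ∀ᶠ x in 𝓝 q, r (σ x) = x)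
    {Y : Π x : P, TangentSpace 𝓘(ℝ, F) x} (hY : CMDiffAt ∞ (T% Y) q) :
    ∃ Y' : Π x : M, TangentSpace 𝓘(ℝ, E) x, CMDiffAt ∞ (T% Y') (σ q) ∧
      ∀ᶠ x in 𝓝 q, Y' (σ x) = mfderiv 𝓘(ℝ, F) 𝓘(ℝ, E) σ x (Y x) := by
  have hrq : r (σ q) = q := hrσ.self_of_nhds
  have hσq : ContinuousAt σ q := (hσ.contMDiffAt (hU.mem_nhds hq)).continuousAt
  let V : M → TangentBundle 𝓘(ℝ, E) M :=
    fun m ↦ tangentMap 𝓘(ℝ, F) 𝓘(ℝ, E) σ ⟨r m, Y (r m)⟩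
  have hV : ContMDiffAt 𝓘(ℝ, E) 𝓘(ℝ, E).tangent ∞ V (σ q) := by
    have h1 : ContMDiffAt 𝓘(ℝ, F) 𝓘(ℝ, F).tangent ∞
      (fun x ↦ (⟨x, Y x⟩ : TangentBundle 𝓘(ℝ, F) P)) (r (σ q)) := by rw [hrq]; exact hY
    exact (contMDiffAt_tangentMap hU hσ (X := ⟨r (σ q), Y (r (σ q))⟩)
      (by simpa [hrq] using hq)).comp (σ q) (h1.comp (σ q) hr)
  obtain ⟨Y', hY', h⟩ := exists_vectorField_eq hV (congrArg σ hrq)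
  refine ⟨Y', hY', ?_⟩
  filter_upwards [hrσ, hσq.eventually h] with x hx hx'
  exact hx' _ (congrArg (fun z : P ↦ tangentMap 𝓘(ℝ, F) 𝓘(ℝ, E) σ ⟨z, Y z⟩) hx)

end RelatedFields

/-! ### The Levi-Civita connection along a map -/

section LeviCivitaAlong

variable {E : Type*} [NormedAddCommGroup E] [NormedSpace ℝ E] [FiniteDimensional ℝ E]
  {M : Type*} [TopologicalSpace M] [ChartedSpace E M] [IsManifold 𝓘(ℝ, E) ∞ M]
  [RiemannianBundle (fun x : M ↦ TangentSpace 𝓘(ℝ, E) x)]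
  [IsContMDiffRiemannianBundle 𝓘(ℝ, E) ∞ E (fun x : M ↦ TangentSpace 𝓘(ℝ, E) x)]
  {F : Type*} [NormedAddCommGroup F] [NormedSpace ℝ F]
  {P : Type*} [TopologicalSpace P] [ChartedSpace F P]
  {G : Type*} [NormedAddCommGroup G] [NormedSpace ℝ G]
  {R : Type*} [TopologicalSpace R] [ChartedSpace G R]

theorem d_ip_eq_inner_leviCivita {Y Z : Π x : M, TangentSpace 𝓘(ℝ, E) x} {x : M}
    (hY : MDiffAt (T% Y) x) (hZ : MDiffAt (T% Z) x) (v : TangentSpace 𝓘(ℝ, E) x) :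
    d% (ip 𝓘(ℝ, E) Y Z) x v = inner ℝ (leviCivita 𝓘(ℝ, E) M Y x v) (Z x) +
      inner ℝ (Y x) (leviCivita 𝓘(ℝ, E) M Z x v) := by
  have h := leviCivita_isMetricCompatible (I := 𝓘(ℝ, E)) (M := M)
  rw [CovariantDerivative.isMetricCompatible_iff] at h
  obtain ⟨X, hX, rfl⟩ : ∃ X : Π x : M, TangentSpace 𝓘(ℝ, E) x, MDiffAt (T% X) x ∧ X x = v :=
    ⟨FiberBundle.extend E v, FiberBundle.mdifferentiableAt_extend .., by simp⟩
  exact h hX hY hZ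

omit [FiniteDimensional ℝ E] [IsManifold 𝓘(ℝ, E) ∞ M]
  [RiemannianBundle (fun x : M ↦ TangentSpace 𝓘(ℝ, E) x)]
  [IsContMDiffRiemannianBundle 𝓘(ℝ, E) ∞ E (fun x : M ↦ TangentSpace 𝓘(ℝ, E) x)] in
theorem mvfderiv_comp_apply {f : P → M} {p : P} {h : M → ℝ} (hh : MDiffAt h (f p))
    (hf : MDifferentiableAt 𝓘(ℝ, F) 𝓘(ℝ, E) f p) (v : TangentSpace 𝓘(ℝ, F) p) :
    d% (h ∘ f) p v = d% h (f p) (mfderiv 𝓘(ℝ, F) 𝓘(ℝ, E) f p v) := by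
  simp only [mvfderiv]
  rw [mfderiv_comp p hh hf]
  rfl

/-- The derivative `∇_{df v} Y` depends only on the values of `Y` along `f`. -/
theorem leviCivita_eq_of_eventuallyEq_comp {f : P → M} {p : P}
    (hf : MDifferentiableAt 𝓘(ℝ, F) 𝓘(ℝ, E) f p)
    {Y Y' : Π x : M, TangentSpace 𝓘(ℝ, E) x} (hY : MDiffAt (T% Y) (f p))
    (hY' : MDiffAt (T% Y') (f p)) (h : ∀ᶠ q in 𝓝 p, Y (f q) = Y' (f q))
    (v : TangentSpace 𝓘(ℝ, F) p) :
    leviCivita 𝓘(ℝ, E) M Y (f p) (mfderiv 𝓘(ℝ, F) 𝓘(ℝ, E) f p v) =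
      leviCivita 𝓘(ℝ, E) M Y' (f p) (mfderiv 𝓘(ℝ, F) 𝓘(ℝ, E) f p v) := by
  refine ext_inner_right ℝ fun w ↦ ?_
  obtain ⟨Z, hZ, rfl⟩ : ∃ Z : Π x : M, TangentSpace 𝓘(ℝ, E) x, MDiffAt (T% Z) (f p) ∧ Z (f p) = w :=
    ⟨FiberBundle.extend E w, FiberBundle.mdifferentiableAt_extend .., by simp⟩
  have h1 := d_ip_eq_inner_leviCivita hY hZ (mfderiv 𝓘(ℝ, F) 𝓘(ℝ, E) f p v)
  have h2 := d_ip_eq_inner_leviCivita hY' hZ (mfderiv 𝓘(ℝ, F) 𝓘(ℝ, E) f p v)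
  rw [← mvfderiv_comp_apply (ip_mdiff hY hZ) hf] at h1
  rw [← mvfderiv_comp_apply (ip_mdiff hY' hZ) hf] at h2
  have h3 : ip 𝓘(ℝ, E) Y Z ∘ f =ᶠ[𝓝 p] ip 𝓘(ℝ, E) Y' Z ∘ f := by
    filter_upwards [h] with q hq
    simp [ip, hq]
  have h4 : d% (ip 𝓘(ℝ, E) Y Z ∘ f) p v = d% (ip 𝓘(ℝ, E) Y' Z ∘ f) p v := by
    simp only [mvfderiv]
    rw [h3.mfderiv_eq]
    rfl
  rw [h.self_of_nhds] at h1
  linarith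

/-- If the immersion `f` is totally geodesic and `Y` is tangent to `f` only along a map `g` into
the domain of `f`, then the derivatives of `Y` along `g` are still tangent to `f`. Indeed the values
of `Y` along `f ∘ g` extend to a field that is tangent to `f` everywhere, namely the image of `Y`
under the derivative of a local retraction onto the image of `f`. -/
theorem IsTotallyGeodesic.exists_mfderiv_eq_leviCivita_comp [IsManifold 𝓘(ℝ, F) ∞ P] {f : P → M}
    (hf : IsTotallyGeodesic (E := E) (F := F) f) {g : R → P} {y₀ : R}
    (hfi : IsImmersionAt 𝓘(ℝ, F) 𝓘(ℝ, E) ∞ f (g y₀))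
    (hg : MDifferentiableAt 𝓘(ℝ, G) 𝓘(ℝ, F) g y₀)
    {Y : Π x : M, TangentSpace 𝓘(ℝ, E) x} (hY : CMDiffAt ∞ (T% Y) (f (g y₀)))
    (hYt : ∀ᶠ y in 𝓝 y₀, ∃ u : TangentSpace 𝓘(ℝ, F) (g y),
      mfderiv 𝓘(ℝ, F) 𝓘(ℝ, E) f (g y) u = Y (f (g y)))
    (v : TangentSpace 𝓘(ℝ, G) y₀) :
    ∃ w : TangentSpace 𝓘(ℝ, F) (g y₀), mfderiv 𝓘(ℝ, F) 𝓘(ℝ, E) f (g y₀) w =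
      leviCivita 𝓘(ℝ, E) M Y (f (g y₀))
        (mfderiv 𝓘(ℝ, F) 𝓘(ℝ, E) f (g y₀) (mfderiv 𝓘(ℝ, G) 𝓘(ℝ, F) g y₀ v)) := by
  obtain ⟨U, ρ, hU, hfU, hρ, hρf⟩ := hfi.exists_leftInverse
  have hfc := hfi.contMDiffAt
  have hρfp : ρ (f (g y₀)) = g y₀ := hρf.self_of_nhds
  have hfD := hfi.contMDiffOn
  set D := hfi.domChart.source
  have hD : IsOpen D := hfi.domChart.open_source
  have hpD : g y₀ ∈ D := hfi.mem_domChart_source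
  let V : M → TangentBundle 𝓘(ℝ, E) M := fun m ↦ tangentMap 𝓘(ℝ, F) 𝓘(ℝ, E) f
    (tangentMap 𝓘(ℝ, E) 𝓘(ℝ, F) ρ ⟨m, Y m⟩)
  have hV : ContMDiffAt 𝓘(ℝ, E) 𝓘(ℝ, E).tangent ∞ V (f (g y₀)) := by
    have h1 := contMDiffAt_tangentMap hU hρ (X := ⟨f (g y₀), Y (f (g y₀))⟩) hfU
    have h2 := contMDiffAt_tangentMap hD hfD
      (X := tangentMap 𝓘(ℝ, E) 𝓘(ℝ, F) ρ ⟨f (g y₀), Y (f (g y₀))⟩)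
      (by change ρ (f (g y₀)) ∈ D; rw [hρfp]; exact hpD)
    exact h2.comp (f (g y₀)) (h1.comp (f (g y₀)) hY)
  obtain ⟨Y', hY', h⟩ := exists_vectorField_eq hV (congrArg f hρfp)
  -- the new field is tangent to `f` at all points of the image of `f`
  have ht : ∀ᶠ q in 𝓝 (g y₀), ∃ u : TangentSpace 𝓘(ℝ, F) q,
      mfderiv 𝓘(ℝ, F) 𝓘(ℝ, E) f q u = Y' (f q) := by
    filter_upwards [hfc.continuousAt.eventually h, hρf] with q hq hρq
    obtain ⟨u, hu⟩ := tangentBundle_exists_eq_mk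
      (X := tangentMap 𝓘(ℝ, E) 𝓘(ℝ, F) ρ ⟨f q, Y (f q)⟩) (x := q) hρq
    refine ⟨u, (hq _ ?_).symm⟩
    simp only [V, hu]
    rfl
  -- along `g` it agrees with `Y`
  have hYY' : ∀ᶠ y in 𝓝 y₀, Y ((f ∘ g) y) = Y' ((f ∘ g) y) := by
    filter_upwards [hg.continuousAt.eventually (hfc.continuousAt.eventually h),
      hg.continuousAt.eventually hρf.eventually_nhds, hg.continuousAt (hD.mem_nhds hpD),
      hg.continuousAt (hfc.continuousAt (hU.mem_nhds hfU)), hYt] with y hy hρy hyD hyU ⟨u, hu⟩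
    refine (hy _ ?_).symm
    have h1 : MDifferentiableAt 𝓘(ℝ, F) 𝓘(ℝ, E) f (g y) :=
      (hfD.contMDiffAt (hD.mem_nhds hyD)).mdifferentiableAt (by simp)
    have h2 : MDifferentiableAt 𝓘(ℝ, E) 𝓘(ℝ, F) ρ (f (g y)) :=
      (hρ.contMDiffAt (hU.mem_nhds hyU)).mdifferentiableAt (by simp)
    have h3 : (⟨f (g y), Y (f (g y))⟩ : TangentBundle 𝓘(ℝ, E) M) =
        tangentMap 𝓘(ℝ, F) 𝓘(ℝ, E) f ⟨g y, u⟩ := by rw [← hu]; rfl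
    have h4 : tangentMap 𝓘(ℝ, E) 𝓘(ℝ, F) ρ (tangentMap 𝓘(ℝ, F) 𝓘(ℝ, E) f ⟨g y, u⟩) =
        ⟨g y, u⟩ := by
      rw [← tangentMap_comp_at ⟨g y, u⟩ h2 h1]
      have h5 : ρ ∘ f =ᶠ[𝓝 (g y)] id := hρy
      refine TotalSpace.ext hρy.self_of_nhds (heq_of_eq ?_)
      change mfderiv 𝓘(ℝ, F) 𝓘(ℝ, F) (ρ ∘ f) (g y) u = u
      rw [h5.mfderiv_eq, mfderiv_id]
      rfl
    simp only [V, Function.comp]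
    rw [h3, h4]
  have hfg : MDifferentiableAt 𝓘(ℝ, G) 𝓘(ℝ, E) (f ∘ g) y₀ :=
    (hfc.mdifferentiableAt (by simp)).comp y₀ hg
  have h6 := leviCivita_eq_of_eventuallyEq_comp hfg (hY.mdifferentiableAt (by simp))
    (hY'.mdifferentiableAt (by simp)) hYY' v
  obtain ⟨w, hw⟩ := hf (g y₀) Y' hY' ht (mfderiv 𝓘(ℝ, G) 𝓘(ℝ, F) g y₀ v)
  refine ⟨w, hw.trans ?_⟩
  rw [mfderiv_comp y₀ (hfc.mdifferentiableAt (by simp)) hg] at h6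
  exact h6.symm

variable [FiniteDimensional ℝ F] [IsManifold 𝓘(ℝ, F) ∞ P]
  [RiemannianBundle (fun x : P ↦ TangentSpace 𝓘(ℝ, F) x)]
  [IsContMDiffRiemannianBundle 𝓘(ℝ, F) ∞ F (fun x : P ↦ TangentSpace 𝓘(ℝ, F) x)]

/-- A map that preserves the metric at a point, and the first derivatives of the inner products of
the fields in question, preserves the Levi-Civita derivatives there, up to a normal component. -/
theorem inner_leviCivita_of_related {σ : P → M} {x : P}
    (hσ : ContMDiffAt 𝓘(ℝ, F) 𝓘(ℝ, E) ∞ σ x)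
    (hiso : ∀ u v : TangentSpace 𝓘(ℝ, F) x, inner ℝ (mfderiv 𝓘(ℝ, F) 𝓘(ℝ, E) σ x u)
      (mfderiv 𝓘(ℝ, F) 𝓘(ℝ, E) σ x v) = inner ℝ u v)
    {X Y Z : Π x : P, TangentSpace 𝓘(ℝ, F) x} {X' Y' Z' : Π x : M, TangentSpace 𝓘(ℝ, E) x}
    (hX : MDiffAt (T% X) x) (hY : MDiffAt (T% Y) x) (hZ : MDiffAt (T% Z) x)
    (hX' : MDiffAt (T% X') (σ x)) (hY' : MDiffAt (T% Y') (σ x)) (hZ' : MDiffAt (T% Z') (σ x))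
    (hXX' : ∀ᶠ y in 𝓝 x, X' (σ y) = mfderiv 𝓘(ℝ, F) 𝓘(ℝ, E) σ y (X y))
    (hYY' : ∀ᶠ y in 𝓝 x, Y' (σ y) = mfderiv 𝓘(ℝ, F) 𝓘(ℝ, E) σ y (Y y))
    (hZZ' : ∀ᶠ y in 𝓝 x, Z' (σ y) = mfderiv 𝓘(ℝ, F) 𝓘(ℝ, E) σ y (Z y))
    (hYZ : d% (ip 𝓘(ℝ, F) Y Z) x = d% (ip 𝓘(ℝ, E) Y' Z' ∘ σ) x)
    (hXZ : d% (ip 𝓘(ℝ, F) X Z) x = d% (ip 𝓘(ℝ, E) X' Z' ∘ σ) x)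
    (hXY : d% (ip 𝓘(ℝ, F) X Y) x = d% (ip 𝓘(ℝ, E) X' Y' ∘ σ) x) :
    inner ℝ (leviCivita 𝓘(ℝ, E) M Y' (σ x) (X' (σ x))) (Z' (σ x)) =
      inner ℝ (leviCivita 𝓘(ℝ, F) P Y x (X x)) (Z x) := by
  have hσd := hσ.mdifferentiableAt (by simp)
  have h1 := inner_leviCivitaFun hX hY hZ
  have h2 := inner_leviCivitaFun hX' hY' hZ'
  refine h2.trans (Eq.trans ?_ h1.symm)
  simp only [koszul]
  rw [mlieBracket_of_related hσ hX hY hX' hY' hXX' hYY',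
    mlieBracket_of_related hσ hX hZ hX' hZ' hXX' hZZ',
    mlieBracket_of_related hσ hY hZ hY' hZ' hYY' hZZ',
    hXX'.self_of_nhds, hYY'.self_of_nhds, hZZ'.self_of_nhds, hiso, hiso, hiso,
    hYZ, hXZ, hXY, mvfderiv_comp_apply (ip_mdiff hY' hZ') hσd,
    mvfderiv_comp_apply (ip_mdiff hX' hZ') hσd, mvfderiv_comp_apply (ip_mdiff hX' hY') hσd]

end LeviCivitaAlong

/-! ### The generator of a circle action -/

section CircleAction

variable {E : Type*} [NormedAddCommGroup E] [NormedSpace ℝ E]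
  {M : Type*} [TopologicalSpace M] [ChartedSpace E M] [IsManifold 𝓘(ℝ, E) ∞ M]
  [MulAction Circle M] [ContMDiffSMul (𝓡 1) 𝓘(ℝ, E) ∞ Circle M]

theorem contMDiff_exp_smul :
    ContMDiff (𝓘(ℝ, ℝ).prod 𝓘(ℝ, E)) 𝓘(ℝ, E) ∞ (fun p : ℝ × M ↦ Circle.exp p.1 • p.2) :=
  (contMDiff_circleExp.comp contMDiff_fst).smul contMDiff_snd

theorem contMDiff_orbit (x : M) :
    ContMDiff 𝓘(ℝ, ℝ) 𝓘(ℝ, E) ∞ (fun t : ℝ ↦ Circle.exp t • x) :=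
  contMDiff_circleExp.smul contMDiff_const

/-- The generator is the image of the smooth field `(∂/∂t, 0)` along `t = 0` under the derivative of
the map `(t, x) ↦ e ^ (i t) • x`. -/
theorem contMDiff_generator : CMDiff ∞ (T% (fun x : M ↦ generator E x)) := by
  have : IsManifold 𝓘(ℝ, E) 1 M := .of_le (n := ∞) (by simp)
  let f0 : M → TangentBundle 𝓘(ℝ, E) M := fun x ↦ TotalSpace.mk' E x 0
  have s0 : CMDiff ∞ f0 := contMDiff_zeroSection _ _
  let f1 : M → TangentBundle 𝓘(ℝ, ℝ) ℝ := fun _ ↦ TotalSpace.mk' ℝ (0 : ℝ) (1 : ℝ)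
  have s1 : CMDiff ∞ f1 := contMDiff_const
  have S₁ := s1.prodMk s0
  have S₂ := contMDiff_equivTangentBundleProd_symm (I := 𝓘(ℝ, ℝ)) (M := ℝ) (I' := 𝓘(ℝ, E))
    (M' := M) (n := ∞)
  have S₃ := (contMDiff_exp_smul (E := E) (M := M)).contMDiff_tangentMap (m := ∞) (by simp)
  have S := (S₃.comp S₂).comp S₁
  convert! S with x
  · simp [f0, f1]
  · simp only [Function.comp_apply, tangentMap, f0, f1]
    rw [mfderiv_prod_eq_add_apply
      ((contMDiff_exp_smul (E := E) (M := M)).mdifferentiableAt (by simp))]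
    change mfderiv 𝓘(ℝ, ℝ) 𝓘(ℝ, E) (fun t : ℝ ↦ Circle.exp t • x) 0 (1 : ℝ) =
      mfderiv 𝓘(ℝ, ℝ) 𝓘(ℝ, E) (fun t : ℝ ↦ Circle.exp t • x) 0 (1 : ℝ) +
        mfderiv 𝓘(ℝ, E) 𝓘(ℝ, E) (fun z : M ↦ Circle.exp 0 • z) x 0
    exact (add_zero _).symm.trans (congrArg _ (ContinuousLinearMap.map_zero _).symm)

theorem mfderiv_orbit (x : M) (t : ℝ) :
    mfderiv 𝓘(ℝ, ℝ) 𝓘(ℝ, E) (fun t : ℝ ↦ Circle.exp t • x) t (1 : ℝ) =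
      generator E (Circle.exp t • x) := by
  have h : (fun t : ℝ ↦ Circle.exp t • x) =
      (fun s : ℝ ↦ Circle.exp s • (Circle.exp t • x)) ∘ (fun u : ℝ ↦ u - t) := by
    ext u
    simp [smul_smul, ← Circle.exp_add]
  have h1 : HasFDerivAt (fun u : ℝ ↦ u - t) (ContinuousLinearMap.id ℝ ℝ) t :=
    (hasFDerivAt_id t).sub_const t
  have h2 : MDifferentiableAt 𝓘(ℝ, ℝ) 𝓘(ℝ, E)
      (fun s : ℝ ↦ Circle.exp s • (Circle.exp t • x)) (t - t) :=
    ((contMDiff_orbit (E := E) _).contMDiffAt).mdifferentiableAt (by simp)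
  have h3 := mfderiv_comp t (f := fun u : ℝ ↦ u - t) h2 h1.differentiableAt.mdifferentiableAt
  rw [← h, h1.hasMFDerivAt.mfderiv] at h3
  have h4 (c : ℝ) (hc : c = 0) : mfderiv 𝓘(ℝ, ℝ) 𝓘(ℝ, E)
      (fun s : ℝ ↦ Circle.exp s • (Circle.exp t • x)) c (1 : ℝ) =
        generator E (Circle.exp t • x) := by
    subst hc; rfl
  rw [h3]
  exact h4 _ (sub_self t)

theorem isMIntegralCurve_orbit (x : M) :
    IsMIntegralCurve (I := 𝓘(ℝ, E)) (fun t : ℝ ↦ Circle.exp t • x) (fun x ↦ generator E x) := by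
  intro t
  have h := ((contMDiff_orbit (E := E) x).contMDiffAt.mdifferentiableAt
    (x := t) (by simp)).hasMFDerivAt
  refine h.congr_mfderiv (ContinuousLinearMap.ext_ring ?_)
  exact (mfderiv_orbit x t).trans (one_smul ℝ _).symm

/-- A free circle action has no stationary points: at a zero of the generator, the constant curve
would be an integral curve, so that the orbit would be a single point. -/
theorem generator_ne_zero [FiniteDimensional ℝ E] [T2Space M]
    (hfree : ∀ (z : Circle) (x : M), z • x = x → z = 1) (x : M) :
    generator E x ≠ 0 := by
  intro hx
  have : CompleteSpace E := FiniteDimensional.complete ℝ E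
  have : IsManifold 𝓘(ℝ, E) 1 M := .of_le (n := ∞) (by simp)
  have h1 : IsMIntegralCurve (I := 𝓘(ℝ, E)) (fun _ : ℝ ↦ x) (fun x ↦ generator E x) := by
    intro t
    simpa [hx] using! hasMFDerivAt_const (I := 𝓘(ℝ, ℝ)) (I' := 𝓘(ℝ, E)) x t
  have h2 := isMIntegralCurve_Ioo_eq_of_contMDiff_boundaryless (I := 𝓘(ℝ, E)) (t₀ := 0)
    ((contMDiff_generator (E := E) (M := M)).of_le (by simp)) (isMIntegralCurve_orbit x) h1
    (by simp)
  have h3 := hfree _ x (congrFun h2 Real.pi)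
  have h4 := congrArg (fun z : Circle ↦ (z : ℂ)) h3
  norm_num [Circle.coe_exp] at h4

/-- A moment map is constant along the orbits: its derivative along the generator `X` is
`⟨J X, X⟩ = 0`. -/
theorem IsMomentMap.map_smul [RiemannianBundle (fun x : M ↦ TangentSpace 𝓘(ℝ, E) x)]
    {J : Π x : M, TangentSpace 𝓘(ℝ, E) x →L[ℝ] TangentSpace 𝓘(ℝ, E) x} {μ : M → ℝ}
    (hμ : IsMomentMap J μ) (hJ : ∀ x (v : TangentSpace 𝓘(ℝ, E) x), inner ℝ (J x v) v = 0)
    (z : Circle) (x : M) : μ (z • x) = μ x := by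
  have hμd (x : M) : MDifferentiableAt 𝓘(ℝ, E) 𝓘(ℝ, ℝ) μ x :=
    hμ.contMDiff.contMDiffAt.mdifferentiableAt (by simp)
  have hγ (t : ℝ) : MDifferentiableAt 𝓘(ℝ, ℝ) 𝓘(ℝ, E) (fun t : ℝ ↦ Circle.exp t • x) t :=
    (contMDiff_orbit (E := E) x).contMDiffAt.mdifferentiableAt (by simp)
  have hd (t : ℝ) : _root_.deriv (fun t : ℝ ↦ μ (Circle.exp t • x)) t = 0 := by
    have h1 := mvfderiv_comp_apply (hμd _) (hγ t) (1 : ℝ)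
    rw [mfderiv_orbit, hμ.deriv, hJ] at h1
    rw [← fderiv_apply_one_eq_deriv, ← mfderiv_eq_fderiv]
    exact h1
  obtain ⟨t, rfl⟩ := Circle.exp_surjective z
  have := is_const_of_deriv_eq_zero
    (fun t ↦ ((hμd _).comp t (hγ t)).differentiableAt) hd t 0
  simpa using this

end CircleAction

/-! ### Horizontal vectors and the metric of the quotient -/

section QuotientMetric

variable {M : Type*} [MulAction Circle M]
  {E : Type*} [NormedAddCommGroup E] [NormedSpace ℝ E] [TopologicalSpace M] [ChartedSpace E M]
  [RiemannianBundle (fun x : M ↦ TangentSpace 𝓘(ℝ, E) x)] {μ : M → ℝ}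
  {EZ : Type*} [NormedAddCommGroup EZ] [NormedSpace ℝ EZ] [ChartedSpace EZ (ZeroLevel μ)]
  {EQ : Type*} [NormedAddCommGroup EQ] [NormedSpace ℝ EQ] [ChartedSpace EQ (OrbitSpace μ)]
  [RiemannianBundle (fun q : OrbitSpace μ ↦ TangentSpace 𝓘(ℝ, EQ) q)]

namespace IsKahlerQuotient

/-- The generator is tangent to `μ⁻¹(0)`, and is killed by the projection to the orbit space.
The differentiability of a single orbit suffices here, so that the lemma applies to the restricted
action on a submanifold without a proof that this action is smooth. -/
theorem exists_vertical (hQ : IsKahlerQuotient (E := E) μ (EZ := EZ) (EQ := EQ))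
    (hinv : ∀ (z : Circle) (x : M), μ (z • x) = μ x) (a : ZeroLevel μ)
    (horb : MDifferentiableAt 𝓘(ℝ, ℝ) 𝓘(ℝ, E) (fun t : ℝ ↦ Circle.exp t • a.1) 0) :
    ∃ ξ : TangentSpace 𝓘(ℝ, EZ) a,
      mfderiv 𝓘(ℝ, EZ) 𝓘(ℝ, E) (Subtype.val : ZeroLevel μ → M) a ξ = generator E a.1 ∧
      mfderiv 𝓘(ℝ, EZ) 𝓘(ℝ, EQ) (OrbitSpace.mk μ) a ξ = 0 := by
  let γ : ℝ → ZeroLevel μ := fun t ↦ ⟨Circle.exp t • a.1, by rw [hinv, a.2]⟩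
  have hγ : MDifferentiableAt 𝓘(ℝ, ℝ) 𝓘(ℝ, EZ) γ 0 :=
    hQ.isSmoothEmbedding.mdifferentiableAt_of_comp (g := γ) horb
  have hγ0 : γ 0 = a := Subtype.ext (by simp [γ])
  have hval := hQ.isSmoothEmbedding.contMDiff.mdifferentiable (by simp)
  have hmk := hQ.isSubmersion.contMDiff.mdifferentiable (by simp)
  have h1 : mfderiv 𝓘(ℝ, ℝ) 𝓘(ℝ, E) (Subtype.val ∘ γ) 0 (1 : ℝ) = generator E (γ 0).1 :=
    congrArg (fun b : ZeroLevel μ ↦ (generator E b.1 : E)) hγ0.symm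
  have h2 : mfderiv 𝓘(ℝ, ℝ) 𝓘(ℝ, EQ) (OrbitSpace.mk μ ∘ γ) 0 = 0 := by
    have : OrbitSpace.mk μ ∘ γ = fun _ ↦ OrbitSpace.mk μ a := by
      ext t
      refine (Quotient.sound (s := orbitSetoid μ) ⟨Circle.exp t, rfl⟩ :
        OrbitSpace.mk μ a = OrbitSpace.mk μ (γ t)).symm
    rw [this]
    exact mfderiv_const
  rw [mfderiv_comp 0 (hval _) hγ] at h1
  rw [mfderiv_comp 0 (hmk _) hγ] at h2
  have h2' := congr($h2 (1 : ℝ))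
  rw [← hγ0]
  exact ⟨_, h1, h2'⟩

/-- The orthogonal projection of a vector tangent to `μ⁻¹(0)` along the generator `X` has the same
image in the quotient. The coefficient is `⟨u, X⟩ / ⟨X, X⟩`, which is `0` if `X` vanishes. -/
theorem exists_horizontal (hQ : IsKahlerQuotient (E := E) μ (EZ := EZ) (EQ := EQ))
    (hinv : ∀ (z : Circle) (x : M), μ (z • x) = μ x) (a : ZeroLevel μ)
    (horb : MDifferentiableAt 𝓘(ℝ, ℝ) 𝓘(ℝ, E) (fun t : ℝ ↦ Circle.exp t • a.1) 0)
    (u : TangentSpace 𝓘(ℝ, EZ) a) :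
    ∃ (c : ℝ) (u' : TangentSpace 𝓘(ℝ, EZ) a),
      mfderiv 𝓘(ℝ, EZ) 𝓘(ℝ, EQ) (OrbitSpace.mk μ) a u' =
        mfderiv 𝓘(ℝ, EZ) 𝓘(ℝ, EQ) (OrbitSpace.mk μ) a u ∧
      mfderiv 𝓘(ℝ, EZ) 𝓘(ℝ, E) (Subtype.val : ZeroLevel μ → M) a u' =
        mfderiv 𝓘(ℝ, EZ) 𝓘(ℝ, E) (Subtype.val : ZeroLevel μ → M) a u - c • generator E a.1 ∧
      inner ℝ (mfderiv 𝓘(ℝ, EZ) 𝓘(ℝ, E) (Subtype.val : ZeroLevel μ → M) a u')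
        (generator E a.1) = 0 := by
  obtain ⟨ξ, hξ, hξ'⟩ := hQ.exists_vertical hinv a horb
  set X := generator E a.1
  set d : TangentSpace 𝓘(ℝ, EZ) a →L[ℝ] TangentSpace 𝓘(ℝ, E) a.1 :=
    mfderiv 𝓘(ℝ, EZ) 𝓘(ℝ, E) (Subtype.val : ZeroLevel μ → M) a
  refine ⟨inner ℝ (d u) X / inner ℝ X X, u - (inner ℝ (d u) X / inner ℝ X X) • ξ, ?_, ?_, ?_⟩
  · rw [map_sub, map_smul, hξ', smul_zero, sub_zero]
  · rw [map_sub, map_smul, hξ]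
  · rw [map_sub, map_smul, hξ, inner_sub_left, inner_smul_left]
    by_cases hX : X = 0
    · simp [hX]
    · have : inner ℝ X X ≠ 0 := inner_self_ne_zero.2 hX
      simp only [conj_trivial]
      field_simp
      ring

/-- The metric of the quotient on the images of two vectors `u`, `v` tangent to `μ⁻¹(0)` is the
inner product of their horizontal parts, `⟨u, v⟩ - ⟨u, X⟩ ⟨v, X⟩ / ⟨X, X⟩`. The denominator is
cleared. -/
theorem inner_generator_mul_inner (hQ : IsKahlerQuotient (E := E) μ (EZ := EZ) (EQ := EQ))
    (hinv : ∀ (z : Circle) (x : M), μ (z • x) = μ x) (a : ZeroLevel μ)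
    (horb : MDifferentiableAt 𝓘(ℝ, ℝ) 𝓘(ℝ, E) (fun t : ℝ ↦ Circle.exp t • a.1) 0)
    (u v : TangentSpace 𝓘(ℝ, EZ) a) :
    inner ℝ (generator E a.1) (generator E a.1) *
        inner ℝ (mfderiv 𝓘(ℝ, EZ) 𝓘(ℝ, EQ) (OrbitSpace.mk μ) a u)
          (mfderiv 𝓘(ℝ, EZ) 𝓘(ℝ, EQ) (OrbitSpace.mk μ) a v) =
      inner ℝ (generator E a.1) (generator E a.1) *
        inner ℝ (mfderiv 𝓘(ℝ, EZ) 𝓘(ℝ, E) (Subtype.val : ZeroLevel μ → M) a u)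
          (mfderiv 𝓘(ℝ, EZ) 𝓘(ℝ, E) (Subtype.val : ZeroLevel μ → M) a v) -
      inner ℝ (mfderiv 𝓘(ℝ, EZ) 𝓘(ℝ, E) (Subtype.val : ZeroLevel μ → M) a u)
          (generator E a.1) *
        inner ℝ (mfderiv 𝓘(ℝ, EZ) 𝓘(ℝ, E) (Subtype.val : ZeroLevel μ → M) a v)
          (generator E a.1) := by
  obtain ⟨c, u', h1, h2, h3⟩ := hQ.exists_horizontal hinv a horb u
  obtain ⟨e, v', k1, k2, k3⟩ := hQ.exists_horizontal hinv a horb v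
  have h4 := hQ.metric a u' v' h3 k3
  rw [h1, k1] at h4
  rw [h4]
  rw [h2] at h3 ⊢
  rw [k2] at k3 ⊢
  set X := generator E a.1
  set d : TangentSpace 𝓘(ℝ, EZ) a →L[ℝ] TangentSpace 𝓘(ℝ, E) a.1 :=
    mfderiv 𝓘(ℝ, EZ) 𝓘(ℝ, E) (Subtype.val : ZeroLevel μ → M) a
  simp only [inner_sub_left, inner_sub_right, inner_smul_left, inner_smul_right,
    conj_trivial] at h3 k3 ⊢
  rw [real_inner_comm (d v) X]
  linear_combination (inner ℝ (d v) X - e * inner ℝ X X) * h3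

/-- Tangent vectors of the quotient have horizontal lifts to `μ⁻¹(0)` that depend linearly on
them. -/
theorem exists_horizontalLift [FiniteDimensional ℝ EQ]
    (hQ : IsKahlerQuotient (E := E) μ (EZ := EZ) (EQ := EQ))
    (hinv : ∀ (z : Circle) (x : M), μ (z • x) = μ x) (a : ZeroLevel μ)
    (horb : MDifferentiableAt 𝓘(ℝ, ℝ) 𝓘(ℝ, E) (fun t : ℝ ↦ Circle.exp t • a.1) 0) :
    ∃ h : TangentSpace 𝓘(ℝ, EQ) (OrbitSpace.mk μ a) →L[ℝ] TangentSpace 𝓘(ℝ, EZ) a,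
      ∀ v, mfderiv 𝓘(ℝ, EZ) 𝓘(ℝ, EQ) (OrbitSpace.mk μ) a (h v) = v ∧
        inner ℝ (mfderiv 𝓘(ℝ, EZ) 𝓘(ℝ, E) (Subtype.val : ZeroLevel μ → M) a (h v))
          (generator E a.1) = 0 := by
  obtain ⟨ξ, hξ, hξ'⟩ := hQ.exists_vertical hinv a horb
  set X := generator E a.1
  set d : TangentSpace 𝓘(ℝ, EZ) a →L[ℝ] TangentSpace 𝓘(ℝ, E) a.1 :=
    mfderiv 𝓘(ℝ, EZ) 𝓘(ℝ, E) (Subtype.val : ZeroLevel μ → M) a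
  set p : TangentSpace 𝓘(ℝ, EZ) a →L[ℝ] TangentSpace 𝓘(ℝ, EQ) (OrbitSpace.mk μ a) :=
    mfderiv 𝓘(ℝ, EZ) 𝓘(ℝ, EQ) (OrbitSpace.mk μ) a
  have hp : Function.Surjective p := (hQ.isSubmersion.isSubmersionAt a).mfderiv_surjective
  obtain ⟨h₀, hh₀⟩ := p.toLinearMap.exists_rightInverse_of_surjective (LinearMap.range_eq_top.2 hp)
  let h₁ : EQ →L[ℝ] EZ := LinearMap.toContinuousLinearMap (E := EQ) (F' := EZ) h₀
  let ℓ : TangentSpace 𝓘(ℝ, EZ) a →L[ℝ] ℝ := (inner ℝ X X)⁻¹ • (innerSL ℝ X ∘L d)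
  let ξ' : EZ := ξ
  let ℓ' : EZ →L[ℝ] ℝ := ℓ
  have hpf (v : TangentSpace 𝓘(ℝ, EQ) (OrbitSpace.mk μ a)) : p (h₀ v) = v := congr($hh₀ v)
  -- any linear right inverse `h₁` of `p` is made horizontal by orthogonal projection along `X`
  refine ⟨h₁ - (ℓ' ∘L h₁).smulRight ξ', fun v ↦ ?_⟩
  change p (h₀ v - ((inner ℝ X X)⁻¹ * inner ℝ X (d (h₀ v))) • ξ) = v ∧
    inner ℝ (d (h₀ v - ((inner ℝ X X)⁻¹ * inner ℝ X (d (h₀ v))) • ξ)) X = 0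
  constructor
  · rw [map_sub, map_smul, hξ', smul_zero, sub_zero, hpf]
  · rw [map_sub, map_smul, hξ, inner_sub_left, inner_smul_left]
    by_cases hX : X = 0
    · simp [hX]
    · have : inner ℝ X X ≠ 0 := inner_self_ne_zero.2 hX
      rw [real_inner_comm X]
      simp only [conj_trivial]
      field_simp
      ring

end IsKahlerQuotient

end QuotientMetric

/-! ### The topology of the orbit spaces -/

section OrbitSpaces

variable {M : Type*} [MulAction Circle M]

theorem OrbitSpace.mk_eq_mk_iff {μ : M → ℝ} {a b : ZeroLevel μ} :
    OrbitSpace.mk μ a = OrbitSpace.mk μ b ↔ ∃ z : Circle, z • a.1 = b.1 :=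
  Quotient.eq (r := orbitSetoid μ)

theorem OrbitSpace.mk_surjective (μ : M → ℝ) : Function.Surjective (OrbitSpace.mk μ) :=
  Quotient.exists_rep

/-- The inclusion `N ∩ μ⁻¹(0) → μ⁻¹(0)`. -/
def ZeroLevel.incl (N : SubMulAction Circle M) (μ : M → ℝ) (a : ZeroLevel fun x : N ↦ μ x) :
    ZeroLevel μ :=
  ⟨a.1.1, a.2⟩

theorem OrbitSpace.incl_injective (N : SubMulAction Circle M) (μ : M → ℝ) :
    Function.Injective (OrbitSpace.incl N μ) := by
  intro p q h
  obtain ⟨a, rfl⟩ := OrbitSpace.mk_surjective _ p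
  obtain ⟨b, rfl⟩ := OrbitSpace.mk_surjective _ q
  obtain ⟨z, hz⟩ := OrbitSpace.mk_eq_mk_iff.1
    (h : OrbitSpace.mk μ (ZeroLevel.incl N μ a) = OrbitSpace.mk μ (ZeroLevel.incl N μ b))
  exact OrbitSpace.mk_eq_mk_iff.2 ⟨z, Subtype.ext hz⟩

/-- The points of `μ⁻¹(0)` over the image of the quotient of `N` are those of `N`. -/
theorem OrbitSpace.mem_of_mk_eq_incl {N : SubMulAction Circle M} {μ : M → ℝ} {b : ZeroLevel μ}
    {p : OrbitSpace fun x : N ↦ μ x} (h : OrbitSpace.mk μ b = OrbitSpace.incl N μ p) :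
    b.1 ∈ N := by
  obtain ⟨a, rfl⟩ := OrbitSpace.mk_surjective _ p
  obtain ⟨z, hz⟩ := OrbitSpace.mk_eq_mk_iff.1
    (h.symm : OrbitSpace.mk μ (ZeroLevel.incl N μ a) = OrbitSpace.mk μ b)
  rw [← hz]
  exact N.smul_mem z a.1.2

variable [TopologicalSpace M]

theorem OrbitSpace.continuous_mk (μ : M → ℝ) : Continuous (OrbitSpace.mk μ) :=
  continuous_quotient_mk'

/-- The projection is open: the saturation of an open set is the union of its translates. -/
theorem OrbitSpace.isOpenMap_mk {μ : M → ℝ} (hinv : ∀ (z : Circle) (x : M), μ (z • x) = μ x)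
    (hc : ∀ z : Circle, Continuous fun x : M ↦ z • x) : IsOpenMap (OrbitSpace.mk μ) := by
  intro W hW
  let act : Circle → ZeroLevel μ → ZeroLevel μ := fun z a ↦ ⟨z • a.1, by rw [hinv, a.2]⟩
  have hact (z : Circle) : Continuous (act z) :=
    ((hc z).comp continuous_subtype_val).subtype_mk _
  refine isOpen_coinduced.2 ?_
  have : OrbitSpace.mk μ ⁻¹' (OrbitSpace.mk μ '' W) = ⋃ z : Circle, act z ⁻¹' W := by
    ext a
    simp only [mem_preimage, mem_image, mem_iUnion]
    constructor
    · rintro ⟨b, hb, hba⟩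
      obtain ⟨z, hz⟩ := OrbitSpace.mk_eq_mk_iff.1 hba.symm
      refine ⟨z, ?_⟩
      have : act z a = b := Subtype.ext hz
      rwa [this]
    · rintro ⟨z, hz⟩
      exact ⟨_, hz, (OrbitSpace.mk_eq_mk_iff.2 ⟨z, rfl⟩).symm⟩
  exact this ▸ isOpen_iUnion fun z ↦ hW.preimage (hact z)

theorem ZeroLevel.isEmbedding_incl (N : SubMulAction Circle M) (μ : M → ℝ) :
    IsEmbedding (ZeroLevel.incl N μ) := by
  refine IsEmbedding.of_comp
    ((continuous_subtype_val.comp continuous_subtype_val).subtype_mk _) continuous_subtype_val ?_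
  exact (IsEmbedding.subtypeVal (p := (· ∈ N))).comp IsEmbedding.subtypeVal

/-- The map of orbit spaces induced by the inclusion of an invariant subset is a topological
embedding, because the projection to the orbit space is open. -/
theorem OrbitSpace.isEmbedding_incl (N : SubMulAction Circle M) {μ : M → ℝ}
    (hinv : ∀ (z : Circle) (x : M), μ (z • x) = μ x)
    (hc : ∀ z : Circle, Continuous fun x : M ↦ z • x) : IsEmbedding (OrbitSpace.incl N μ) := by
  refine ⟨⟨le_antisymm ?_ ?_⟩, OrbitSpace.incl_injective N μ⟩
  · rw [← continuous_iff_le_induced]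
    exact continuous_quot_lift _
      ((OrbitSpace.continuous_mk μ).comp (ZeroLevel.isEmbedding_incl N μ).continuous)
  · intro U hU
    have hU' : IsOpen (OrbitSpace.mk (fun x : N ↦ μ x) ⁻¹' U) :=
      hU.preimage (OrbitSpace.continuous_mk _)
    obtain ⟨W, hW, hWU⟩ := (ZeroLevel.isEmbedding_incl N μ).isOpen_iff.1 hU'
    refine isOpen_induced_iff.2 ⟨OrbitSpace.mk μ '' W, OrbitSpace.isOpenMap_mk hinv hc W hW, ?_⟩
    ext p
    obtain ⟨a, rfl⟩ := OrbitSpace.mk_surjective _ p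
    constructor
    · rintro ⟨b, hb, hba⟩
      -- the orbit of `a` meets `W` in a point of `N`, as `N` is invariant
      have hbN : b.1 ∈ N := OrbitSpace.mem_of_mk_eq_incl hba
      let b' : ZeroLevel fun x : N ↦ μ x := ⟨⟨b.1, hbN⟩, b.2⟩
      have hb' : b' ∈ ZeroLevel.incl N μ ⁻¹' W := hb
      rw [hWU] at hb'
      have : OrbitSpace.mk _ b' = OrbitSpace.mk _ a := OrbitSpace.incl_injective N μ hba
      rw [← this]
      exact hb'
    · intro ha
      have ha' : a ∈ ZeroLevel.incl N μ ⁻¹' W := by rw [hWU]; exact ha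
      exact ⟨_, ha', rfl⟩

end OrbitSpaces

/-! ### Tangent vectors of a level set -/

section LevelSet

variable {E : Type*} [NormedAddCommGroup E] [NormedSpace ℝ E] [FiniteDimensional ℝ E]
  {M : Type*} [TopologicalSpace M] [ChartedSpace E M] [IsManifold 𝓘(ℝ, E) ∞ M] {μ : M → ℝ}
  {EZ : Type*} [NormedAddCommGroup EZ] [NormedSpace ℝ EZ] [ChartedSpace EZ (ZeroLevel μ)]

/-- At a regular point every vector in the kernel of the derivative of `μ` is tangent to
`μ⁻¹(0)`. -/
theorem exists_mfderiv_val_eq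
    (hZ : IsSmoothEmbedding 𝓘(ℝ, EZ) 𝓘(ℝ, E) ∞ (Subtype.val : ZeroLevel μ → M))
    (a : ZeroLevel μ) (hμ : ContMDiffAt 𝓘(ℝ, E) 𝓘(ℝ, ℝ) ∞ μ a.1) (hreg : d% μ a.1 ≠ 0)
    {v : TangentSpace 𝓘(ℝ, E) a.1} (hv : d% μ a.1 v = 0) :
    ∃ u : TangentSpace 𝓘(ℝ, EZ) a,
      mfderiv 𝓘(ℝ, EZ) 𝓘(ℝ, E) (Subtype.val : ZeroLevel μ → M) a u = v := by
  have : CompleteSpace E := FiniteDimensional.complete ℝ E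
  have : IsManifold 𝓘(ℝ, E) 1 M := .of_le (n := ∞) (by simp)
  set φ := extChartAt 𝓘(ℝ, E) a.1 with hφ
  have hx : φ.symm (φ a.1) = a.1 := extChartAt_to_inv a.1
  let f : E → ℝ := μ ∘ φ.symm
  have hf : ContDiffAt ℝ ∞ f (φ a.1) := by
    have := (contMDiffAt_iff.1 hμ).2
    simpa only [modelWithCornersSelf_coe, range_id, contDiffWithinAt_univ,
      extChartAt_model_space_eq_id, PartialEquiv.refl_coe, Function.id_comp] using this
  have hfs : HasStrictFDerivAt f (fderiv ℝ f (φ a.1)) (φ a.1) :=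
    hf.hasStrictFDerivAt (by simp)
  have hφd : MDifferentiableAt 𝓘(ℝ, E) 𝓘(ℝ, E) φ a.1 :=
    mdifferentiableAt_extChartAt (mem_chart_source E a.1)
  have hφs : MDifferentiableAt 𝓘(ℝ, E) 𝓘(ℝ, E) φ.symm (φ a.1) :=
    mdifferentiableAt_of_isInvertible_mfderiv
      (isInvertible_mfderiv_extChartAt_symm a.1 (mem_extChartAt_target a.1))
  let A : E →L[ℝ] E := mfderiv 𝓘(ℝ, E) 𝓘(ℝ, E) φ a.1
  let A' : E →L[ℝ] E := mfderiv 𝓘(ℝ, E) 𝓘(ℝ, E) φ.symm (φ a.1)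
  let dμ : E →L[ℝ] ℝ := d% μ a.1
  have hAA' (w : E) : A' (A w) = w := by
    have h1 : φ.symm ∘ φ =ᶠ[𝓝 a.1] id := by
      filter_upwards [extChartAt_source_mem_nhds (I := 𝓘(ℝ, E)) a.1] with z hz
        using φ.left_inv hz
    have h2 := h1.mfderiv_eq (I := 𝓘(ℝ, E)) (I' := 𝓘(ℝ, E))
    rw [mfderiv_comp a.1 hφs hφd, mfderiv_id] at h2
    exact congr($h2 w)
  -- in the chart, the derivative of `μ` is that of `f`
  have hfd (w : E) : fderiv ℝ f (φ a.1) (A w) = dμ w := by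
    have h1 : f ∘ φ =ᶠ[𝓝 a.1] μ := by
      filter_upwards [extChartAt_source_mem_nhds (I := 𝓘(ℝ, E)) a.1] with z hz
      simp [f, φ.left_inv hz]
    have h2 := h1.mfderiv_eq (I := 𝓘(ℝ, E)) (I' := 𝓘(ℝ, ℝ))
    rw [mfderiv_comp a.1 (hf.differentiableAt (by simp)).mdifferentiableAt hφd,
      mfderiv_eq_fderiv] at h2
    exact congr($h2 w)
  have hrange : (fderiv ℝ f (φ a.1) : E →ₗ[ℝ] ℝ).range = ⊤ := by
    refine LinearMap.range_eq_top.2 (LinearMap.surjective fun h ↦ hreg ?_)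
    ext w
    exact (hfd w).symm.trans congr($h (A w))
  let w : (fderiv ℝ f (φ a.1) : E →ₗ[ℝ] ℝ).ker := ⟨A v, (hfd v).trans hv⟩
  -- the curve in the level set with velocity `v`, given by the implicit function theorem
  let g : ℝ → E := fun t ↦ hfs.implicitFunction f _ hrange (f (φ a.1)) (t • w)
  have hg : HasFDerivAt g ((ContinuousLinearMap.id ℝ ℝ).smulRight (A v)) 0 := by
    have h1 := (hfs.to_implicitFunction hrange).hasFDerivAt
    have h2 : HasFDerivAt (fun t : ℝ ↦ t • w) ((ContinuousLinearMap.id ℝ ℝ).smulRight w) 0 :=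
      ((ContinuousLinearMap.id ℝ ℝ).smulRight w).hasFDerivAt
    rw [← zero_smul ℝ w] at h1
    refine (h1.comp (0 : ℝ) h2).congr_fderiv ?_
    ext
    simp [w]
  have hg0 : g 0 = φ a.1 := by simp [g, hfs.implicitFunction_apply_image hrange]
  have hlev : ∀ᶠ t in 𝓝 (0 : ℝ), μ (φ.symm (g t)) = 0 := by
    have h1 := hfs.map_implicitFunction_eq hrange
    have h2 : Filter.Tendsto (fun t : ℝ ↦ (f (φ a.1), t • w)) (𝓝 0) (𝓝 (f (φ a.1), 0)) := by
      have : Continuous fun t : ℝ ↦ (f (φ a.1), t • w) := by fun_prop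
      simpa using this.tendsto 0
    filter_upwards [h2.eventually h1] with t ht
    refine ht.trans ?_
    simp [f, hx, a.2]
  classical
  let γ : ℝ → ZeroLevel μ := fun t ↦
    if h : μ (φ.symm (g t)) = 0 then ⟨φ.symm (g t), h⟩ else a
  have hγ : Subtype.val ∘ γ =ᶠ[𝓝 0] φ.symm ∘ g := by
    filter_upwards [hlev] with t ht
    simp [γ, ht]
  have hγ0 : γ 0 = a := by
    refine Subtype.ext ?_
    exact hγ.self_of_nhds.trans (by simp [hg0, hx])
  rw [← hg0] at hφs
  have hd := hφs.comp 0 hg.differentiableAt.mdifferentiableAt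
  have hγd : MDifferentiableAt 𝓘(ℝ, ℝ) 𝓘(ℝ, EZ) γ 0 :=
    hZ.mdifferentiableAt_of_comp (hd.congr_of_eventuallyEq hγ)
  have h3 : (mfderiv 𝓘(ℝ, ℝ) 𝓘(ℝ, E) (Subtype.val ∘ γ) 0 (1 : ℝ) : E) = v := by
    rw [hγ.mfderiv_eq, mfderiv_comp 0 hφs hg.differentiableAt.mdifferentiableAt,
      hg.hasMFDerivAt.mfderiv]
    rw [hg0]
    change A' ((1 : ℝ) • A v) = v
    rw [one_smul]
    exact hAA' v
  rw [mfderiv_comp 0 (hZ.contMDiff.mdifferentiable (by simp) _) hγd] at h3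
  rw [← hγ0]
  exact ⟨_, h3⟩

end LevelSet

/-! ### Functions that agree to first order -/

section FirstOrder

variable {F : Type*} [NormedAddCommGroup F] [NormedSpace ℝ F]
  {P : Type*} [TopologicalSpace P] [ChartedSpace F P]

/-- If `f g = f g' - α β` with `f ≠ 0` at `x`, and `α` and `β` both vanish at `x`, then the
correction `α β / f` vanishes to second order, so that `g` and `g'` have the same derivative
at `x`. -/
theorem mvfderiv_eq_of_mul_eq_sub_mul {f g g' α β : P → ℝ} {x : P} (hf : MDiffAt f x)
    (hg : MDiffAt g x) (hg' : MDiffAt g' x) (hα : MDiffAt α x) (hβ : MDiffAt β x)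
    (h : ∀ᶠ y in 𝓝 x, f y * g y = f y * g' y - α y * β y) (hfx : f x ≠ 0) (hαx : α x = 0)
    (hβx : β x = 0) : d% g x = d% g' x := by
  have hx : g x = g' x := by
    have := h.self_of_nhds
    rw [hαx, zero_mul, sub_zero] at this
    exact mul_left_cancel₀ hfx this
  have h1 : d% (f * g + α * β) x = d% (f * g') x := by
    have : f * g + α * β =ᶠ[𝓝 x] f * g' := by
      filter_upwards [h] with y hy
      simp [hy]
    simp only [mvfderiv]
    rw [this.mfderiv_eq]
    rfl
  rw [mvfderiv_add (hf.mul hg) (hα.mul hβ), mvfderiv_mul hf hg, mvfderiv_mul hf hg',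
    mvfderiv_mul hα hβ, hαx, hβx, hx, zero_smul, zero_smul, add_zero, add_zero] at h1
  have h2 := add_right_cancel h1
  exact smul_right_injective _ hfx h2

/-- Inner products at two equal base points agree. The vectors are compared in the model space `F`,
to which all tangent spaces are definitionally equal. -/
theorem inner_tangentSpace_congr
    [RiemannianBundle (fun x : P ↦ TangentSpace 𝓘(ℝ, F) x)] {x y : P} (h : x = y)
    {u v : TangentSpace 𝓘(ℝ, F) x} {u' v' : TangentSpace 𝓘(ℝ, F) y} (hu : (u : F) = (u' : F))
    (hv : (v : F) = (v' : F)) : (inner ℝ u v : ℝ) = inner ℝ u' v' := by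
  subst h
  have hu' : u = u' := hu
  have hv' : v = v' := hv
  rw [hu', hv']

end FirstOrder

/-! ### The natural map between the quotients -/

section NaturalMap

variable {E : Type*} [NormedAddCommGroup E] [NormedSpace ℝ E] [FiniteDimensional ℝ E]
  {M : Type*} [TopologicalSpace M] [T2Space M] [ChartedSpace E M] [IsManifold 𝓘(ℝ, E) ∞ M]
  [RiemannianBundle (fun x : M ↦ TangentSpace 𝓘(ℝ, E) x)]
  [IsContMDiffRiemannianBundle 𝓘(ℝ, E) ∞ E (fun x : M ↦ TangentSpace 𝓘(ℝ, E) x)]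
  {J : Π x : M, TangentSpace 𝓘(ℝ, E) x →L[ℝ] TangentSpace 𝓘(ℝ, E) x}
  [MulAction Circle M] [ContMDiffSMul (𝓡 1) 𝓘(ℝ, E) ∞ Circle M]
  {μ : M → ℝ} {N : SubMulAction Circle M}
  {EN : Type*} [NormedAddCommGroup EN] [NormedSpace ℝ EN] [FiniteDimensional ℝ EN]
  [ChartedSpace EN N] [IsManifold 𝓘(ℝ, EN) ∞ N]
  [RiemannianBundle (fun x : N ↦ TangentSpace 𝓘(ℝ, EN) x)]
  [IsContMDiffRiemannianBundle 𝓘(ℝ, EN) ∞ EN (fun x : N ↦ TangentSpace 𝓘(ℝ, EN) x)]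
  {EZ : Type*} [NormedAddCommGroup EZ] [NormedSpace ℝ EZ] [FiniteDimensional ℝ EZ]
  [ChartedSpace EZ (ZeroLevel μ)] [IsManifold 𝓘(ℝ, EZ) ∞ (ZeroLevel μ)]
  {EQ : Type*} [NormedAddCommGroup EQ] [NormedSpace ℝ EQ] [FiniteDimensional ℝ EQ]
  [ChartedSpace EQ (OrbitSpace μ)] [IsManifold 𝓘(ℝ, EQ) ∞ (OrbitSpace μ)]
  [RiemannianBundle (fun q : OrbitSpace μ ↦ TangentSpace 𝓘(ℝ, EQ) q)]
  [IsContMDiffRiemannianBundle 𝓘(ℝ, EQ) ∞ EQ (fun q : OrbitSpace μ ↦ TangentSpace 𝓘(ℝ, EQ) q)]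
  {FZ : Type*} [NormedAddCommGroup FZ] [NormedSpace ℝ FZ] [FiniteDimensional ℝ FZ]
  [ChartedSpace FZ (ZeroLevel fun x : N ↦ μ x)]
  [IsManifold 𝓘(ℝ, FZ) ∞ (ZeroLevel fun x : N ↦ μ x)]
  {FQ : Type*} [NormedAddCommGroup FQ] [NormedSpace ℝ FQ] [FiniteDimensional ℝ FQ]
  [ChartedSpace FQ (OrbitSpace fun x : N ↦ μ x)]
  [IsManifold 𝓘(ℝ, FQ) ∞ (OrbitSpace fun x : N ↦ μ x)]
  [RiemannianBundle (fun q : OrbitSpace (fun x : N ↦ μ x) ↦ TangentSpace 𝓘(ℝ, FQ) q)]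

theorem IsKahler.inner_apply_self (hJ : IsKahler J) (x : M) (v : TangentSpace 𝓘(ℝ, E) x) :
    inner ℝ (J x v) v = 0 := by
  have h := hJ.orthogonal x v (J x v)
  rw [hJ.sq, inner_neg_right, real_inner_comm] at h
  rw [real_inner_comm]
  linarith

theorem IsComplexTotallyGeodesic.mdifferentiableAt_orbit
    (hN : IsComplexTotallyGeodesic J N (EN := EN)) (x : N) (t : ℝ) :
    MDifferentiableAt 𝓘(ℝ, ℝ) 𝓘(ℝ, EN) (fun t : ℝ ↦ Circle.exp t • x) t :=
  hN.isSmoothEmbedding.mdifferentiableAt_of_comp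
    ((contMDiff_orbit (E := E) x.1).contMDiffAt.mdifferentiableAt (by simp))

theorem IsComplexTotallyGeodesic.mfderiv_generator
    (hN : IsComplexTotallyGeodesic J N (EN := EN)) (x : N) :
    mfderiv 𝓘(ℝ, EN) 𝓘(ℝ, E) (Subtype.val : N → M) x (generator EN x) = generator E x.1 := by
  have h1 : mfderiv 𝓘(ℝ, ℝ) 𝓘(ℝ, E) (Subtype.val ∘ fun t : ℝ ↦ Circle.exp t • x) 0 (1 : ℝ) =
    generator E x.1 := rfl
  rw [mfderiv_comp 0 (hN.isSmoothEmbedding.contMDiff.mdifferentiable (by simp) _)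
    (hN.mdifferentiableAt_orbit x 0)] at h1
  have h2 (y : N) (hy : y = x) : (mfderiv 𝓘(ℝ, EN) 𝓘(ℝ, E) (Subtype.val : N → M) y : EN →L[ℝ] E) =
      mfderiv 𝓘(ℝ, EN) 𝓘(ℝ, E) (Subtype.val : N → M) x := by rw [hy]
  refine Eq.trans ?_ h1
  exact congr($(h2 (Circle.exp 0 • x) (by simp)) _).symm

theorem contMDiff_zeroLevel_incl (hN : IsComplexTotallyGeodesic J N (EN := EN))
    (hQ : IsKahlerQuotient (E := E) μ (EZ := EZ) (EQ := EQ))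
    (hQN : IsKahlerQuotient (E := EN) (fun x : N ↦ μ x) (EZ := FZ) (EQ := FQ)) :
    ContMDiff 𝓘(ℝ, FZ) 𝓘(ℝ, EZ) ∞ (ZeroLevel.incl N μ) := fun a ↦
  hQ.isSmoothEmbedding.contMDiffAt_of_comp (g := ZeroLevel.incl N μ)
    ((hN.isSmoothEmbedding.contMDiff.comp hQN.isSmoothEmbedding.contMDiff) a)

/-- The natural map of the quotients is smooth: it is covered by the smooth map
`N ∩ μ⁻¹(0) → μ⁻¹(0)`, and the projection of `N ∩ μ⁻¹(0)` has smooth local sections. -/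
theorem contMDiff_orbitSpace_incl (hinv : ∀ (z : Circle) (x : M), μ (z • x) = μ x)
    (hN : IsComplexTotallyGeodesic J N (EN := EN))
    (hQ : IsKahlerQuotient (E := E) μ (EZ := EZ) (EQ := EQ))
    (hQN : IsKahlerQuotient (E := EN) (fun x : N ↦ μ x) (EZ := FZ) (EQ := FQ)) :
    ContMDiff 𝓘(ℝ, FQ) 𝓘(ℝ, EQ) ∞ (OrbitSpace.incl N μ) := by
  intro p
  obtain ⟨a, rfl⟩ := OrbitSpace.mk_surjective _ p
  obtain ⟨h, hh⟩ := hQN.exists_horizontalLift (fun z x ↦ hinv z x) a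
    (hN.mdifferentiableAt_orbit a.1 0)
  obtain ⟨V, s, hV, hpV, hs, -, hms, -⟩ :=
    (hQN.isSubmersion.isSubmersionAt a).exists_section h fun v ↦ (hh v).1
  have h1 : ContMDiffAt 𝓘(ℝ, FQ) 𝓘(ℝ, EQ) ∞ (OrbitSpace.mk μ ∘ ZeroLevel.incl N μ ∘ s)
      (OrbitSpace.mk _ a) :=
    (hQ.isSubmersion.contMDiff _).comp _
      ((contMDiff_zeroLevel_incl hN hQ hQN _).comp _ (hs.contMDiffAt (hV.mem_nhds hpV)))
  refine h1.congr_of_eventuallyEq ?_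
  filter_upwards [hV.mem_nhds hpV] with x hx
  exact (congrArg (OrbitSpace.incl N μ) (hms x hx)).symm

theorem mfderiv_val_incl (hN : IsComplexTotallyGeodesic J N (EN := EN))
    (hQ : IsKahlerQuotient (E := E) μ (EZ := EZ) (EQ := EQ))
    (hQN : IsKahlerQuotient (E := EN) (fun x : N ↦ μ x) (EZ := FZ) (EQ := FQ))
    (a : ZeroLevel fun x : N ↦ μ x) (u : TangentSpace 𝓘(ℝ, FZ) a) :
    mfderiv 𝓘(ℝ, EZ) 𝓘(ℝ, E) (Subtype.val : ZeroLevel μ → M) (ZeroLevel.incl N μ a)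
        (mfderiv 𝓘(ℝ, FZ) 𝓘(ℝ, EZ) (ZeroLevel.incl N μ) a u) =
      mfderiv 𝓘(ℝ, EN) 𝓘(ℝ, E) (Subtype.val : N → M) a.1
        (mfderiv 𝓘(ℝ, FZ) 𝓘(ℝ, EN) (Subtype.val : (ZeroLevel fun x : N ↦ μ x) → N) a u) := by
  have h1 := mfderiv_comp a
    (hQ.isSmoothEmbedding.contMDiff.mdifferentiable (by simp) (ZeroLevel.incl N μ a))
    ((contMDiff_zeroLevel_incl hN hQ hQN).mdifferentiable (by simp) a)
  have h2 := mfderiv_comp a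
    (hN.isSmoothEmbedding.contMDiff.mdifferentiable (by simp) a.1)
    (hQN.isSmoothEmbedding.contMDiff.mdifferentiable (by simp) a)
  exact congr($(h1.symm.trans h2) u)

theorem mfderiv_mk_incl (hinv : ∀ (z : Circle) (x : M), μ (z • x) = μ x)
    (hN : IsComplexTotallyGeodesic J N (EN := EN))
    (hQ : IsKahlerQuotient (E := E) μ (EZ := EZ) (EQ := EQ))
    (hQN : IsKahlerQuotient (E := EN) (fun x : N ↦ μ x) (EZ := FZ) (EQ := FQ))
    (a : ZeroLevel fun x : N ↦ μ x) (u : TangentSpace 𝓘(ℝ, FZ) a) :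
    mfderiv 𝓘(ℝ, EZ) 𝓘(ℝ, EQ) (OrbitSpace.mk μ) (ZeroLevel.incl N μ a)
        (mfderiv 𝓘(ℝ, FZ) 𝓘(ℝ, EZ) (ZeroLevel.incl N μ) a u) =
      mfderiv 𝓘(ℝ, FQ) 𝓘(ℝ, EQ) (OrbitSpace.incl N μ) (OrbitSpace.mk _ a)
        (mfderiv 𝓘(ℝ, FZ) 𝓘(ℝ, FQ) (OrbitSpace.mk fun x : N ↦ μ x) a u) := by
  have h1 := mfderiv_comp a
    (hQ.isSubmersion.contMDiff.mdifferentiable (by simp) (ZeroLevel.incl N μ a))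
    ((contMDiff_zeroLevel_incl hN hQ hQN).mdifferentiable (by simp) a)
  have h2 := mfderiv_comp a
    ((contMDiff_orbitSpace_incl hinv hN hQ hQN).mdifferentiable (by simp) (OrbitSpace.mk _ a))
    (hQN.isSubmersion.contMDiff.mdifferentiable (by simp) a)
  exact congr($(h1.symm.trans h2) u)

/-- The natural map of the quotients is isometric: horizontal lifts to `N ∩ μ⁻¹(0)` are horizontal
lifts to `μ⁻¹(0)`, as `N` contains the orbits of its points. -/
theorem isIsometric_orbitSpace_incl (hinv : ∀ (z : Circle) (x : M), μ (z • x) = μ x)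
    (hN : IsComplexTotallyGeodesic J N (EN := EN))
    (hQ : IsKahlerQuotient (E := E) μ (EZ := EZ) (EQ := EQ))
    (hQN : IsKahlerQuotient (E := EN) (fun x : N ↦ μ x) (EZ := FZ) (EQ := FQ)) :
    IsIsometric (E := EQ) (F := FQ) (OrbitSpace.incl N μ) := by
  intro p v w
  obtain ⟨a, rfl⟩ := OrbitSpace.mk_surjective _ p
  obtain ⟨h, hh⟩ := hQN.exists_horizontalLift (fun z x ↦ hinv z x) a
    (hN.mdifferentiableAt_orbit a.1 0)
  have hhor (v) : inner ℝ (mfderiv 𝓘(ℝ, EZ) 𝓘(ℝ, E) (Subtype.val : ZeroLevel μ → M)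
      (ZeroLevel.incl N μ a) (mfderiv 𝓘(ℝ, FZ) 𝓘(ℝ, EZ) (ZeroLevel.incl N μ) a (h v)))
      (generator E (ZeroLevel.incl N μ a).1) = 0 := by
    rw [mfderiv_val_incl hN hQ hQN]
    refine (congrArg _ (hN.mfderiv_generator a.1).symm).trans ?_
    exact (hN.isIsometric _ _ _).trans (hh v).2
  have h1 := hQ.metric _ _ _ (hhor v) (hhor w)
  rw [mfderiv_mk_incl hinv hN hQ hQN, mfderiv_mk_incl hinv hN hQ hQN, (hh v).1, (hh w).1,
    mfderiv_val_incl hN hQ hQN, mfderiv_val_incl hN hQ hQN] at h1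
  have h2 := hQN.metric _ _ _ (hh v).2 (hh w).2
  rw [(hh v).1, (hh w).1] at h2
  exact h1.trans ((hN.isIsometric _ _ _).trans h2.symm)

/-- A horizontal vector of `μ⁻¹(0)` that is orthogonal to the quotient of `N` is orthogonal to `N`.
Indeed the tangent space of `N` is spanned by the generator `X`, by `J X`, which is the gradient of
`μ`, and by the tangent space of `N ∩ μ⁻¹(0)`. -/
theorem inner_mfderiv_val_eq_zero (hfree : ∀ (z : Circle) (x : M), z • x = x → z = 1)
    (hJ : IsKahler J) (hμ : IsMomentMap J μ)
    (hN : IsComplexTotallyGeodesic J N (EN := EN))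
    (hQ : IsKahlerQuotient (E := E) μ (EZ := EZ) (EQ := EQ))
    (hQN : IsKahlerQuotient (E := EN) (fun x : N ↦ μ x) (EZ := FZ) (EQ := FQ))
    (a : ZeroLevel fun x : N ↦ μ x) {w : TangentSpace 𝓘(ℝ, EZ) (ZeroLevel.incl N μ a)}
    (hw : inner ℝ (mfderiv 𝓘(ℝ, EZ) 𝓘(ℝ, E) (Subtype.val : ZeroLevel μ → M) _ w)
      (generator E (ZeroLevel.incl N μ a).1) = 0)
    (hw' : ∀ u : TangentSpace 𝓘(ℝ, FZ) a,
      inner ℝ (mfderiv 𝓘(ℝ, EZ) 𝓘(ℝ, EQ) (OrbitSpace.mk μ) (ZeroLevel.incl N μ a)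
          (mfderiv 𝓘(ℝ, FZ) 𝓘(ℝ, EZ) (ZeroLevel.incl N μ) a u))
        (mfderiv 𝓘(ℝ, EZ) 𝓘(ℝ, EQ) (OrbitSpace.mk μ) (ZeroLevel.incl N μ a) w) = 0)
    (n : TangentSpace 𝓘(ℝ, EN) a.1) :
    inner ℝ (mfderiv 𝓘(ℝ, EN) 𝓘(ℝ, E) (Subtype.val : N → M) a.1 n)
      (mfderiv 𝓘(ℝ, EZ) 𝓘(ℝ, E) (Subtype.val : ZeroLevel μ → M) (ZeroLevel.incl N μ a) w) = 0 := by
  have hinv := hμ.map_smul hJ.inner_apply_self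
  set x : M := a.1.1
  set X : TangentSpace 𝓘(ℝ, E) x := generator E x
  set W : TangentSpace 𝓘(ℝ, E) x :=
    mfderiv 𝓘(ℝ, EZ) 𝓘(ℝ, E) (Subtype.val : ZeroLevel μ → M) (ZeroLevel.incl N μ a) w
  set d : TangentSpace 𝓘(ℝ, EN) a.1 →L[ℝ] TangentSpace 𝓘(ℝ, E) x :=
    mfderiv 𝓘(ℝ, EN) 𝓘(ℝ, E) (Subtype.val : N → M) a.1
  have hX : X ≠ 0 := generator_ne_zero hfree x
  have hJX : inner ℝ (J x X) (J x X) ≠ 0 := by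
    rw [hJ.orthogonal]; exact inner_self_ne_zero.2 hX
  have hμd : MDifferentiableAt 𝓘(ℝ, E) 𝓘(ℝ, ℝ) μ x :=
    hμ.contMDiff.contMDiffAt.mdifferentiableAt (by simp)
  -- the horizontal vector is orthogonal to the gradient of `μ`, as `μ` vanishes on `μ⁻¹(0)`
  have hWJX : inner ℝ (J x X) W = 0 := by
    rw [← hμ.deriv]
    have h1 := mvfderiv_comp_apply (f := (Subtype.val : ZeroLevel μ → M))
      (p := ZeroLevel.incl N μ a) hμd
      (hQ.isSmoothEmbedding.contMDiff.mdifferentiable (by simp) _) w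
    have h2 : μ ∘ (Subtype.val : ZeroLevel μ → M) = fun _ ↦ 0 := funext fun b ↦ b.2
    rw [h2] at h1
    refine h1.symm.trans ?_
    simp [mvfderiv]
  -- the gradient of `μ` is tangent to `N`
  obtain ⟨g, hg⟩ := hN.complex a.1 (generator EN a.1)
  rw [hN.mfderiv_generator] at hg
  have hgX : d g = J x X := hg
  have hμN : ContMDiff 𝓘(ℝ, EN) 𝓘(ℝ, ℝ) ∞ fun y : N ↦ μ y :=
    hμ.contMDiff.comp hN.isSmoothEmbedding.contMDiff
  have hdμN (v : TangentSpace 𝓘(ℝ, EN) a.1) :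
      d% (fun y : N ↦ μ y) a.1 v = inner ℝ (J x X) (d v) := by
    rw [← hμ.deriv]
    exact mvfderiv_comp_apply hμd (hN.isSmoothEmbedding.contMDiff.mdifferentiable (by simp) a.1) v
  have hreg : d% (fun y : N ↦ μ y) a.1 ≠ 0 := by
    intro h
    have h1 := hdμN g
    rw [h, hgX] at h1
    exact hJX h1.symm
  set c : ℝ := inner ℝ (J x X) (d n) / inner ℝ (J x X) (J x X)
  obtain ⟨u, hu⟩ := exists_mfderiv_val_eq hQN.isSmoothEmbedding a hμN.contMDiffAt hreg
    (v := n - c • g) (by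
      rw [hdμN, map_sub, map_smul, hgX, inner_sub_right, inner_smul_right, div_mul_cancel₀ _ hJX,
        sub_self])
  -- reduction to vectors tangent to the zero level, by the formula for the metric of the quotient
  have h1 := hQ.inner_generator_mul_inner hinv (ZeroLevel.incl N μ a)
    ((contMDiff_orbit (E := E) _).contMDiffAt.mdifferentiableAt (by simp))
    (mfderiv 𝓘(ℝ, FZ) 𝓘(ℝ, EZ) (ZeroLevel.incl N μ) a u) w
  rw [hw, mul_zero, sub_zero, hw', mul_zero,
    mfderiv_val_incl hN hQ hQN, hu] at h1
  have h2 : inner ℝ (d (n - c • g)) W = 0 :=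
    (mul_eq_zero.1 h1.symm).resolve_left (inner_self_ne_zero.2 hX)
  rw [map_sub, map_smul, hgX, inner_sub_left, inner_smul_left, hWJX, mul_zero, sub_zero] at h2
  exact h2

end NaturalMap

/-! ### Horizontal sections of the projection -/

section HorizontalSection

variable {E : Type*} [NormedAddCommGroup E] [NormedSpace ℝ E] [FiniteDimensional ℝ E]
  {M : Type*} [TopologicalSpace M] [ChartedSpace E M] [IsManifold 𝓘(ℝ, E) ∞ M]
  [RiemannianBundle (fun x : M ↦ TangentSpace 𝓘(ℝ, E) x)]
  [IsContMDiffRiemannianBundle 𝓘(ℝ, E) ∞ E (fun x : M ↦ TangentSpace 𝓘(ℝ, E) x)]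
  [MulAction Circle M] [ContMDiffSMul (𝓡 1) 𝓘(ℝ, E) ∞ Circle M]
  {μ : M → ℝ}
  {EZ : Type*} [NormedAddCommGroup EZ] [NormedSpace ℝ EZ]
  [ChartedSpace EZ (ZeroLevel μ)] [IsManifold 𝓘(ℝ, EZ) ∞ (ZeroLevel μ)]
  {EQ : Type*} [NormedAddCommGroup EQ] [NormedSpace ℝ EQ] [FiniteDimensional ℝ EQ]
  [ChartedSpace EQ (OrbitSpace μ)] [IsManifold 𝓘(ℝ, EQ) ∞ (OrbitSpace μ)]
  [RiemannianBundle (fun q : OrbitSpace μ ↦ TangentSpace 𝓘(ℝ, EQ) q)]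
  [IsContMDiffRiemannianBundle 𝓘(ℝ, EQ) ∞ EQ (fun q : OrbitSpace μ ↦ TangentSpace 𝓘(ℝ, EQ) q)]

namespace IsKahlerQuotient

/-- The projection to the quotient has a smooth local section through every point that is horizontal
at that point. -/
theorem exists_section (hQ : IsKahlerQuotient (E := E) μ (EZ := EZ) (EQ := EQ))
    (hinv : ∀ (z : Circle) (x : M), μ (z • x) = μ x) (b : ZeroLevel μ) :
    ∃ (V : Set (OrbitSpace μ)) (s : OrbitSpace μ → ZeroLevel μ), IsOpen V ∧ OrbitSpace.mk μ b ∈ V ∧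
      ContMDiffOn 𝓘(ℝ, EQ) 𝓘(ℝ, EZ) ∞ s V ∧ s (OrbitSpace.mk μ b) = b ∧
      (∀ x ∈ V, OrbitSpace.mk μ (s x) = x) ∧ (∀ x ∉ V, s x = b) ∧
      ∀ w : TangentSpace 𝓘(ℝ, EQ) (OrbitSpace.mk μ b),
        inner ℝ (mfderiv 𝓘(ℝ, EQ) 𝓘(ℝ, E) (fun x ↦ (s x).1) (OrbitSpace.mk μ b) w)
          (generator E (s (OrbitSpace.mk μ b)).1) = 0 := by
  obtain ⟨h, hh⟩ := hQ.exists_horizontalLift hinv b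
    ((contMDiff_orbit (E := E) _).contMDiffAt.mdifferentiableAt (by simp))
  obtain ⟨V, s, hV, hbV, hs, hsb, hms, hsV, hds⟩ :=
    (hQ.isSubmersion.isSubmersionAt b).exists_section h fun v ↦ (hh v).1
  refine ⟨V, s, hV, hbV, hs, hsb, hms, hsV, fun w ↦ ?_⟩
  have h1 := mfderiv_comp (OrbitSpace.mk μ b) (g := (Subtype.val : ZeroLevel μ → M))
    (hQ.isSmoothEmbedding.contMDiff.mdifferentiable (by simp) _)
    ((hs.contMDiffAt (hV.mem_nhds hbV)).mdifferentiableAt (by simp))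
  rw [hds] at h1
  refine (inner_tangentSpace_congr (congrArg Subtype.val hsb) ?_ ?_).trans (hh w).2
  · refine congr($h1 w).trans ?_
    have h2 (c : ZeroLevel μ) (hc : c = b) :
        (mfderiv 𝓘(ℝ, EZ) 𝓘(ℝ, E) (Subtype.val : ZeroLevel μ → M) c : EZ →L[ℝ] E) =
          mfderiv 𝓘(ℝ, EZ) 𝓘(ℝ, E) (Subtype.val : ZeroLevel μ → M) b := by rw [hc]
    exact congr($(h2 _ hsb) (h w))
  · exact congrArg (fun z : ZeroLevel μ ↦ (generator E z.1 : E)) hsb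

/-- The metric of the quotient in terms of a section of the projection. -/
theorem inner_generator_mul_inner_section (hQ : IsKahlerQuotient (E := E) μ (EZ := EZ) (EQ := EQ))
    (hinv : ∀ (z : Circle) (x : M), μ (z • x) = μ x)
    {V : Set (OrbitSpace μ)} {s : OrbitSpace μ → ZeroLevel μ} (hV : IsOpen V)
    (hs : ContMDiffOn 𝓘(ℝ, EQ) 𝓘(ℝ, EZ) ∞ s V) (hms : ∀ x ∈ V, OrbitSpace.mk μ (s x) = x)
    {x : OrbitSpace μ} (hx : x ∈ V) (u v : TangentSpace 𝓘(ℝ, EQ) x) :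
    inner ℝ (generator E (s x).1) (generator E (s x).1) * inner ℝ u v =
      inner ℝ (generator E (s x).1) (generator E (s x).1) *
        inner ℝ (mfderiv 𝓘(ℝ, EQ) 𝓘(ℝ, E) (fun x ↦ (s x).1) x u)
          (mfderiv 𝓘(ℝ, EQ) 𝓘(ℝ, E) (fun x ↦ (s x).1) x v) -
      inner ℝ (mfderiv 𝓘(ℝ, EQ) 𝓘(ℝ, E) (fun x ↦ (s x).1) x u) (generator E (s x).1) *
        inner ℝ (mfderiv 𝓘(ℝ, EQ) 𝓘(ℝ, E) (fun x ↦ (s x).1) x v) (generator E (s x).1) := by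
  have hsx := (hs.contMDiffAt (hV.mem_nhds hx)).mdifferentiableAt (n := ∞) (by simp)
  have h1 := mfderiv_comp x (g := (Subtype.val : ZeroLevel μ → M))
    (hQ.isSmoothEmbedding.contMDiff.mdifferentiable (by simp) _) hsx
  have h2 := mfderiv_comp x (g := OrbitSpace.mk μ)
    (hQ.isSubmersion.contMDiff.mdifferentiable (by simp) _) hsx
  have h3 : OrbitSpace.mk μ ∘ s =ᶠ[𝓝 x] id := by
    filter_upwards [hV.mem_nhds hx] with y hy using hms y hy
  rw [h3.mfderiv_eq, mfderiv_id] at h2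
  have h4 := hQ.inner_generator_mul_inner hinv (s x)
    ((contMDiff_orbit (E := E) _).contMDiffAt.mdifferentiableAt (by simp))
    (mfderiv 𝓘(ℝ, EQ) 𝓘(ℝ, EZ) s x u) (mfderiv 𝓘(ℝ, EQ) 𝓘(ℝ, EZ) s x v)
  have h5 (w : TangentSpace 𝓘(ℝ, EQ) x) :
      mfderiv 𝓘(ℝ, EQ) 𝓘(ℝ, E) (fun x ↦ (s x).1) x w =
        mfderiv 𝓘(ℝ, EZ) 𝓘(ℝ, E) (Subtype.val : ZeroLevel μ → M) (s x)
          (mfderiv 𝓘(ℝ, EQ) 𝓘(ℝ, EZ) s x w) := congr($h1 w)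
  rw [h5, h5, ← h4]
  congr 1
  exact inner_tangentSpace_congr (hms x hx).symm congr($h2 u) congr($h2 v)

/-- Comparison of the Levi-Civita connections of `M` and of the quotient along a section of the
projection that is horizontal at the given point: the metric induced by the section agrees there to
first order with that of the quotient. -/
theorem exists_inner_leviCivita_eq (hQ : IsKahlerQuotient (E := E) μ (EZ := EZ) (EQ := EQ))
    (hinv : ∀ (z : Circle) (x : M), μ (z • x) = μ x)
    (hX : ∀ x : M, generator E x ≠ 0)
    {V : Set (OrbitSpace μ)} {s : OrbitSpace μ → ZeroLevel μ} (hV : IsOpen V)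
    (hs : ContMDiffOn 𝓘(ℝ, EQ) 𝓘(ℝ, EZ) ∞ s V) (hms : ∀ x ∈ V, OrbitSpace.mk μ (s x) = x)
    {q : OrbitSpace μ} (hq : q ∈ V)
    (hhor : ∀ w : TangentSpace 𝓘(ℝ, EQ) q,
      inner ℝ (mfderiv 𝓘(ℝ, EQ) 𝓘(ℝ, E) (fun x ↦ (s x).1) q w) (generator E (s q).1) = 0)
    {Y : Π x : OrbitSpace μ, TangentSpace 𝓘(ℝ, EQ) x} (hY : CMDiffAt ∞ (T% Y) q) :
    ∃ Y' : Π x : M, TangentSpace 𝓘(ℝ, E) x, CMDiffAt ∞ (T% Y') (s q).1 ∧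
      (∀ᶠ x in 𝓝 q, Y' (s x).1 = mfderiv 𝓘(ℝ, EQ) 𝓘(ℝ, E) (fun x ↦ (s x).1) x (Y x)) ∧
      ∀ u w : TangentSpace 𝓘(ℝ, EQ) q,
        inner ℝ (leviCivita 𝓘(ℝ, E) M Y' (s q).1
            (mfderiv 𝓘(ℝ, EQ) 𝓘(ℝ, E) (fun x ↦ (s x).1) q u))
          (mfderiv 𝓘(ℝ, EQ) 𝓘(ℝ, E) (fun x ↦ (s x).1) q w) =
        inner ℝ (leviCivita 𝓘(ℝ, EQ) (OrbitSpace μ) Y q u) w := by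
  set σ : OrbitSpace μ → M := fun x ↦ (s x).1 with hσdef
  have hσ : ContMDiffOn 𝓘(ℝ, EQ) 𝓘(ℝ, E) ∞ σ V :=
    hQ.isSmoothEmbedding.contMDiff.comp_contMDiffOn hs
  have hσq := hσ.contMDiffAt (hV.mem_nhds hq)
  have hσd : MDifferentiableAt 𝓘(ℝ, EQ) 𝓘(ℝ, E) σ q := hσq.mdifferentiableAt (by simp)
  -- the projection composed with a local retraction onto `μ⁻¹(0)` is a left inverse of the section
  obtain ⟨U, ρ, hU, hqU, hρ, hρs⟩ :=
    (hQ.isSmoothEmbedding.isImmersion.isImmersionAt (s q)).exists_leftInverse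
  have hr : ContMDiffAt 𝓘(ℝ, E) 𝓘(ℝ, EQ) ∞ (OrbitSpace.mk μ ∘ ρ) (σ q) :=
    (hQ.isSubmersion.contMDiff _).comp _ (hρ.contMDiffAt (hU.mem_nhds hqU))
  have hrσ : ∀ᶠ x in 𝓝 q, (OrbitSpace.mk μ ∘ ρ) (σ x) = x := by
    filter_upwards [(hs.contMDiffAt (hV.mem_nhds hq)).continuousAt.eventually hρs,
      hV.mem_nhds hq] with x hx hxV
    exact (congrArg (OrbitSpace.mk μ) hx).trans (hms x hxV)
  have hgen : MDiffAt (T% (fun x : M ↦ generator E x)) (σ q) :=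
    (contMDiff_generator (E := E) (M := M)).mdifferentiable (by simp) _
  -- inner products of related fields agree to first order
  have hip {A B : Π x : OrbitSpace μ, TangentSpace 𝓘(ℝ, EQ) x}
      {A' B' : Π x : M, TangentSpace 𝓘(ℝ, E) x}
      (hA : MDiffAt (T% A) q) (hB : MDiffAt (T% B) q)
      (hA' : MDiffAt (T% A') (σ q)) (hB' : MDiffAt (T% B') (σ q))
      (hAA' : ∀ᶠ x in 𝓝 q, A' (σ x) = mfderiv 𝓘(ℝ, EQ) 𝓘(ℝ, E) σ x (A x))
      (hBB' : ∀ᶠ x in 𝓝 q, B' (σ x) = mfderiv 𝓘(ℝ, EQ) 𝓘(ℝ, E) σ x (B x)) :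
      d% (ip 𝓘(ℝ, EQ) A B) q = d% (ip 𝓘(ℝ, E) A' B' ∘ σ) q := by
    refine mvfderiv_eq_of_mul_eq_sub_mul
      (f := ip 𝓘(ℝ, E) (fun x : M ↦ generator E x) (fun x : M ↦ generator E x) ∘ σ)
      (α := ip 𝓘(ℝ, E) A' (fun x : M ↦ generator E x) ∘ σ)
      (β := ip 𝓘(ℝ, E) B' (fun x : M ↦ generator E x) ∘ σ)
      ((ip_mdiff hgen hgen).comp q hσd) (ip_mdiff hA hB) ((ip_mdiff hA' hB').comp q hσd)
      ((ip_mdiff hA' hgen).comp q hσd) ((ip_mdiff hB' hgen).comp q hσd) ?_ ?_ ?_ ?_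
    · filter_upwards [hV.mem_nhds hq, hAA', hBB'] with x hx hxA hxB
      simp only [ip, Function.comp_apply]
      rw [hxA, hxB]
      exact hQ.inner_generator_mul_inner_section hinv hV hs hms hx (A x) (B x)
    · exact inner_self_ne_zero.2 (hX _)
    · simp only [ip, Function.comp_apply]
      rw [hAA'.self_of_nhds]
      exact hhor _
    · simp only [ip, Function.comp_apply]
      rw [hBB'.self_of_nhds]
      exact hhor _
  have hiso (u v : TangentSpace 𝓘(ℝ, EQ) q) : inner ℝ (mfderiv 𝓘(ℝ, EQ) 𝓘(ℝ, E) σ q u)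
      (mfderiv 𝓘(ℝ, EQ) 𝓘(ℝ, E) σ q v) = inner ℝ u v := by
    have h1 := hQ.inner_generator_mul_inner_section hinv hV hs hms hq u v
    rw [hhor u, zero_mul, sub_zero] at h1
    exact (mul_left_cancel₀ (inner_self_ne_zero.2 (hX _)) h1).symm
  obtain ⟨Y', hY', hYY'⟩ := exists_related_vectorField hV hq hσ hr hrσ hY
  refine ⟨Y', hY', hYY', fun u w ↦ ?_⟩
  obtain ⟨A, hA, rfl⟩ : ∃ A : Π x : OrbitSpace μ, TangentSpace 𝓘(ℝ, EQ) x,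
      CMDiffAt ∞ (T% A) q ∧ A q = u :=
    ⟨FiberBundle.extend EQ u, FiberBundle.contMDiffAt_extend .., by simp⟩
  obtain ⟨B, hB, rfl⟩ : ∃ B : Π x : OrbitSpace μ, TangentSpace 𝓘(ℝ, EQ) x,
      CMDiffAt ∞ (T% B) q ∧ B q = w :=
    ⟨FiberBundle.extend EQ w, FiberBundle.contMDiffAt_extend .., by simp⟩
  obtain ⟨A', hA', hAA'⟩ := exists_related_vectorField hV hq hσ hr hrσ hA
  obtain ⟨B', hB', hBB'⟩ := exists_related_vectorField hV hq hσ hr hrσ hB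
  replace hY := hY.mdifferentiableAt (by simp)
  replace hA := hA.mdifferentiableAt (by simp)
  replace hB := hB.mdifferentiableAt (by simp)
  replace hY' := hY'.mdifferentiableAt (by simp)
  replace hA' := hA'.mdifferentiableAt (by simp)
  replace hB' := hB'.mdifferentiableAt (by simp)
  have h1 := inner_leviCivita_of_related hσq hiso hA hY hB hA' hY' hB' hAA' hYY' hBB'
    (hip hY hB hY' hB' hYY' hBB') (hip hA hB hA' hB' hAA' hBB') (hip hA hY hA' hY' hAA' hYY')
  rw [hAA'.self_of_nhds, hBB'.self_of_nhds] at h1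
  exact h1

end IsKahlerQuotient

end HorizontalSection

/-! ### The quotient of a totally geodesic submanifold -/

section TotalGeodesy

variable {E : Type*} [NormedAddCommGroup E] [NormedSpace ℝ E] [FiniteDimensional ℝ E]
  {M : Type*} [TopologicalSpace M] [T2Space M] [ChartedSpace E M] [IsManifold 𝓘(ℝ, E) ∞ M]
  [RiemannianBundle (fun x : M ↦ TangentSpace 𝓘(ℝ, E) x)]
  [IsContMDiffRiemannianBundle 𝓘(ℝ, E) ∞ E (fun x : M ↦ TangentSpace 𝓘(ℝ, E) x)]
  {J : Π x : M, TangentSpace 𝓘(ℝ, E) x →L[ℝ] TangentSpace 𝓘(ℝ, E) x}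
  [MulAction Circle M] [ContMDiffSMul (𝓡 1) 𝓘(ℝ, E) ∞ Circle M]
  {μ : M → ℝ} {N : SubMulAction Circle M}
  {EN : Type*} [NormedAddCommGroup EN] [NormedSpace ℝ EN] [FiniteDimensional ℝ EN]
  [ChartedSpace EN N] [IsManifold 𝓘(ℝ, EN) ∞ N]
  [RiemannianBundle (fun x : N ↦ TangentSpace 𝓘(ℝ, EN) x)]
  [IsContMDiffRiemannianBundle 𝓘(ℝ, EN) ∞ EN (fun x : N ↦ TangentSpace 𝓘(ℝ, EN) x)]
  {EZ : Type*} [NormedAddCommGroup EZ] [NormedSpace ℝ EZ] [FiniteDimensional ℝ EZ]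
  [ChartedSpace EZ (ZeroLevel μ)] [IsManifold 𝓘(ℝ, EZ) ∞ (ZeroLevel μ)]
  {EQ : Type*} [NormedAddCommGroup EQ] [NormedSpace ℝ EQ] [FiniteDimensional ℝ EQ]
  [ChartedSpace EQ (OrbitSpace μ)] [IsManifold 𝓘(ℝ, EQ) ∞ (OrbitSpace μ)]
  [RiemannianBundle (fun q : OrbitSpace μ ↦ TangentSpace 𝓘(ℝ, EQ) q)]
  [IsContMDiffRiemannianBundle 𝓘(ℝ, EQ) ∞ EQ (fun q : OrbitSpace μ ↦ TangentSpace 𝓘(ℝ, EQ) q)]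
  {FZ : Type*} [NormedAddCommGroup FZ] [NormedSpace ℝ FZ] [FiniteDimensional ℝ FZ]
  [ChartedSpace FZ (ZeroLevel fun x : N ↦ μ x)]
  [IsManifold 𝓘(ℝ, FZ) ∞ (ZeroLevel fun x : N ↦ μ x)]
  {FQ : Type*} [NormedAddCommGroup FQ] [NormedSpace ℝ FQ] [FiniteDimensional ℝ FQ]
  [ChartedSpace FQ (OrbitSpace fun x : N ↦ μ x)]
  [IsManifold 𝓘(ℝ, FQ) ∞ (OrbitSpace fun x : N ↦ μ x)]
  [RiemannianBundle (fun q : OrbitSpace (fun x : N ↦ μ x) ↦ TangentSpace 𝓘(ℝ, FQ) q)]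

/-- The natural map of the quotients is totally geodesic. A section that is horizontal at the given
point carries fields on the quotient to fields on `M`. Over the quotient of `N` it takes values in
`N`, hence the derivative of a tangent field is tangent to `N`, and a horizontal vector orthogonal
to the quotient of `N` is orthogonal to `N`. -/
theorem isTotallyGeodesic_orbitSpace_incl (hfree : ∀ (z : Circle) (x : M), z • x = x → z = 1)
    (hJ : IsKahler J) (hμ : IsMomentMap J μ)
    (hN : IsComplexTotallyGeodesic J N (EN := EN))
    (hQ : IsKahlerQuotient (E := E) μ (EZ := EZ) (EQ := EQ))
    (hQN : IsKahlerQuotient (E := EN) (fun x : N ↦ μ x) (EZ := FZ) (EQ := FQ)) :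
    IsTotallyGeodesic (E := EQ) (F := FQ) (OrbitSpace.incl N μ) := by
  intro p Y hY hYt v
  have hinv := hμ.map_smul hJ.inner_apply_self
  set ι := OrbitSpace.incl N μ
  have hι : ContMDiff 𝓘(ℝ, FQ) 𝓘(ℝ, EQ) ∞ ι := contMDiff_orbitSpace_incl hinv hN hQ hQN
  obtain ⟨b, hb⟩ := OrbitSpace.mk_surjective μ (ι p)
  obtain ⟨V, s, hV, hqV, hs, hsb, hms, hsV, hhor⟩ := hQ.exists_section hinv b
  rw [hb] at hqV hsb hhor
  have hbN : b.1 ∈ N := OrbitSpace.mem_of_mk_eq_incl hb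
  -- the section maps the quotient of `N` into `N`
  have hmem (x : OrbitSpace fun x : N ↦ μ x) : (s (ι x)).1 ∈ N := by
    by_cases hx : ι x ∈ V
    · exact OrbitSpace.mem_of_mk_eq_incl (hms _ hx)
    · rw [hsV _ hx]; exact hbN
  let τ : OrbitSpace (fun x : N ↦ μ x) → N := fun x ↦ ⟨(s (ι x)).1, hmem x⟩
  obtain ⟨Y', hY', hYY', hcov⟩ := hQ.exists_inner_leviCivita_eq hinv
    (generator_ne_zero hfree) hV hs hms hqV hhor hY
  let σ : OrbitSpace μ → M := fun x ↦ (s x).1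
  have hσ : ContMDiffOn 𝓘(ℝ, EQ) 𝓘(ℝ, E) ∞ σ V :=
    hQ.isSmoothEmbedding.contMDiff.comp_contMDiffOn hs
  have hσd {x} (hx : x ∈ V) : MDifferentiableAt 𝓘(ℝ, EQ) 𝓘(ℝ, E) σ x :=
    (hσ.contMDiffAt (hV.mem_nhds hx)).mdifferentiableAt (by simp)
  have hιd := hι.mdifferentiable (by simp)
  have hτd {x} (hx : ι x ∈ V) : MDifferentiableAt 𝓘(ℝ, FQ) 𝓘(ℝ, EN) τ x :=
    hN.isSmoothEmbedding.mdifferentiableAt_of_comp (g := τ) ((hσd hx).comp x (hιd x))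
  have hchain {x} (hx : ι x ∈ V) (u : TangentSpace 𝓘(ℝ, FQ) x) :
      mfderiv 𝓘(ℝ, EQ) 𝓘(ℝ, E) σ (ι x) (mfderiv 𝓘(ℝ, FQ) 𝓘(ℝ, EQ) ι x u) =
        mfderiv 𝓘(ℝ, EN) 𝓘(ℝ, E) (Subtype.val : N → M) (τ x)
          (mfderiv 𝓘(ℝ, FQ) 𝓘(ℝ, EN) τ x u) := by
    have h1 := mfderiv_comp x (hσd hx) (hιd x)
    have h2 := mfderiv_comp x (g := (Subtype.val : N → M)) (f := τ)
      (hN.isSmoothEmbedding.contMDiff.mdifferentiable (by simp) _) (hτd hx)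
    exact congr($(h1.symm.trans h2) u)
  have hYN : ∀ᶠ x in 𝓝 p, ∃ u : TangentSpace 𝓘(ℝ, EN) (τ x),
      mfderiv 𝓘(ℝ, EN) 𝓘(ℝ, E) (Subtype.val : N → M) (τ x) u = Y' (τ x).1 := by
    filter_upwards [hYt, hι.continuous.continuousAt.eventually hYY',
      hι.continuous.continuousAt (hV.mem_nhds hqV)] with x ⟨u, hu⟩ hx hxV
    exact ⟨_, (hchain hxV u).symm.trans ((congrArg _ hu).trans hx.symm)⟩
  -- `Y'` need only be tangent to `N` along `τ`, not along all of `N`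
  obtain ⟨n, hn⟩ := hN.isTotallyGeodesic.exists_mfderiv_eq_leviCivita_comp
    (hN.isSmoothEmbedding.isImmersion.isImmersionAt (τ p)) (hτd hqV) hY' hYN v
  rw [← hchain hqV] at hn
  let dι : TangentSpace 𝓘(ℝ, FQ) p →ₗ[ℝ] TangentSpace 𝓘(ℝ, EQ) (ι p) :=
    (mfderiv 𝓘(ℝ, FQ) 𝓘(ℝ, EQ) ι p).toLinearMap
  have : FiniteDimensional ℝ (TangentSpace 𝓘(ℝ, EQ) (ι p)) :=
    inferInstanceAs (FiniteDimensional ℝ EQ)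
  -- a subspace of a finite-dimensional space is its own double orthogonal complement
  change leviCivita 𝓘(ℝ, EQ) (OrbitSpace μ) Y (ι p) (mfderiv 𝓘(ℝ, FQ) 𝓘(ℝ, EQ) ι p v) ∈ dι.range
  rw [← Submodule.orthogonal_orthogonal dι.range, Submodule.mem_orthogonal']
  intro w hw
  rw [← hcov]
  -- the point of `N ∩ μ⁻¹(0)` on the section
  let a : ZeroLevel fun x : N ↦ μ x := ⟨τ p, (s (ι p)).2⟩
  have ha : OrbitSpace.mk (fun x : N ↦ μ x) a = p :=
    OrbitSpace.incl_injective N μ (hms _ hqV)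
  have hsd : MDifferentiableAt 𝓘(ℝ, EQ) 𝓘(ℝ, EZ) s (ι p) :=
    (hs.contMDiffAt (hV.mem_nhds hqV)).mdifferentiableAt (by simp)
  have hσs (w : TangentSpace 𝓘(ℝ, EQ) (ι p)) : mfderiv 𝓘(ℝ, EQ) 𝓘(ℝ, E) σ (ι p) w =
      mfderiv 𝓘(ℝ, EZ) 𝓘(ℝ, E) (Subtype.val : ZeroLevel μ → M) (ZeroLevel.incl N μ a)
        (mfderiv 𝓘(ℝ, EQ) 𝓘(ℝ, EZ) s (ι p) w) :=
    congr($(mfderiv_comp (ι p) (g := (Subtype.val : ZeroLevel μ → M))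
      (hQ.isSmoothEmbedding.contMDiff.mdifferentiable (by simp) _) hsd) w)
  have hmkw : (mfderiv 𝓘(ℝ, EZ) 𝓘(ℝ, EQ) (OrbitSpace.mk μ) (ZeroLevel.incl N μ a)
      (mfderiv 𝓘(ℝ, EQ) 𝓘(ℝ, EZ) s (ι p) w) : EQ) = w := by
    have h1 := mfderiv_comp (ι p) (g := OrbitSpace.mk μ)
      (hQ.isSubmersion.contMDiff.mdifferentiable (by simp) _) hsd
    have h2 : OrbitSpace.mk μ ∘ s =ᶠ[𝓝 (ι p)] id := by
      filter_upwards [hV.mem_nhds hqV] with y hy using hms y hy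
    rw [h2.mfderiv_eq, mfderiv_id] at h1
    exact congr($h1 w).symm
  have hfinal := inner_mfderiv_val_eq_zero hfree hJ hμ hN hQ hQN a
    (w := mfderiv 𝓘(ℝ, EQ) 𝓘(ℝ, EZ) s (ι p) w)
    (by rw [← hσs]; exact hhor w)
    (fun u ↦ by
      rw [mfderiv_mk_incl hinv hN hQ hQN]
      have h1 (p' : OrbitSpace fun x : N ↦ μ x) (hp' : p' = p) (y : TangentSpace 𝓘(ℝ, FQ) p')
          (w' : TangentSpace 𝓘(ℝ, EQ) (ι p')) (hw' : (w' : EQ) = w) :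
          inner ℝ (mfderiv 𝓘(ℝ, FQ) 𝓘(ℝ, EQ) ι p' y) w' = 0 := by
        subst hp'
        have hw'' : w' = w := hw'
        rw [hw'']
        exact Submodule.mem_orthogonal _ _ |>.1 hw _ ⟨y, rfl⟩
      exact h1 _ ha _ _ hmkw) n
  rw [← hσs] at hfinal
  exact (congrArg (fun z ↦ inner ℝ z (mfderiv 𝓘(ℝ, EQ) 𝓘(ℝ, E) σ (ι p) w)) hn).symm.trans hfinal

end TotalGeodesy

end KahlerQuot

theorem mainTheorem11
    {E : Type*} [NormedAddCommGroup E] [NormedSpace ℝ E] [FiniteDimensional ℝ E]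
    {M : Type*} [TopologicalSpace M] [T2Space M] [ChartedSpace E M] [IsManifold 𝓘(ℝ, E) ∞ M]
    [RiemannianBundle (fun x : M ↦ TangentSpace 𝓘(ℝ, E) x)]
    [IsContMDiffRiemannianBundle 𝓘(ℝ, E) ∞ E (fun x : M ↦ TangentSpace 𝓘(ℝ, E) x)]
    (J : Π x : M, TangentSpace 𝓘(ℝ, E) x →L[ℝ] TangentSpace 𝓘(ℝ, E) x)
    (hJ : KahlerQuot.IsKahler J)
    -- a free smooth circle action on `M` preserving the Kähler structure, with moment map `μ`
    [MulAction Circle M] [ContMDiffSMul (𝓡 1) 𝓘(ℝ, E) ∞ Circle M]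
    (hfree : ∀ (z : Circle) (x : M), z • x = x → z = 1)
    (hact : KahlerQuot.PreservesKahler J)
    (μ : M → ℝ) (hμ : KahlerQuot.IsMomentMap J μ)
    -- an invariant complex totally geodesic submanifold `N`
    (N : SubMulAction Circle M)
    {EN : Type*} [NormedAddCommGroup EN] [NormedSpace ℝ EN] [FiniteDimensional ℝ EN]
    [ChartedSpace EN N] [IsManifold 𝓘(ℝ, EN) ∞ N]
    [RiemannianBundle (fun x : N ↦ TangentSpace 𝓘(ℝ, EN) x)]
    [IsContMDiffRiemannianBundle 𝓘(ℝ, EN) ∞ EN (fun x : N ↦ TangentSpace 𝓘(ℝ, EN) x)]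
    (hN : KahlerQuot.IsComplexTotallyGeodesic J N (EN := EN))
    -- the Kähler quotient of `M`
    {EZ : Type*} [NormedAddCommGroup EZ] [NormedSpace ℝ EZ] [FiniteDimensional ℝ EZ]
    [ChartedSpace EZ (KahlerQuot.ZeroLevel μ)] [IsManifold 𝓘(ℝ, EZ) ∞ (KahlerQuot.ZeroLevel μ)]
    {EQ : Type*} [NormedAddCommGroup EQ] [NormedSpace ℝ EQ] [FiniteDimensional ℝ EQ]
    [ChartedSpace EQ (KahlerQuot.OrbitSpace μ)] [IsManifold 𝓘(ℝ, EQ) ∞ (KahlerQuot.OrbitSpace μ)]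
    [RiemannianBundle (fun q : KahlerQuot.OrbitSpace μ ↦ TangentSpace 𝓘(ℝ, EQ) q)]
    [IsContMDiffRiemannianBundle 𝓘(ℝ, EQ) ∞ EQ
      (fun q : KahlerQuot.OrbitSpace μ ↦ TangentSpace 𝓘(ℝ, EQ) q)]
    (hQ : KahlerQuot.IsKahlerQuotient (E := E) μ (EZ := EZ) (EQ := EQ))
    -- the Kähler quotient of `N`
    {FZ : Type*} [NormedAddCommGroup FZ] [NormedSpace ℝ FZ] [FiniteDimensional ℝ FZ]
    [ChartedSpace FZ (KahlerQuot.ZeroLevel fun x : N ↦ μ x)]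
    [IsManifold 𝓘(ℝ, FZ) ∞ (KahlerQuot.ZeroLevel fun x : N ↦ μ x)]
    {FQ : Type*} [NormedAddCommGroup FQ] [NormedSpace ℝ FQ] [FiniteDimensional ℝ FQ]
    [ChartedSpace FQ (KahlerQuot.OrbitSpace fun x : N ↦ μ x)]
    [IsManifold 𝓘(ℝ, FQ) ∞ (KahlerQuot.OrbitSpace fun x : N ↦ μ x)]
    [RiemannianBundle (fun q : KahlerQuot.OrbitSpace (fun x : N ↦ μ x) ↦ TangentSpace 𝓘(ℝ, FQ) q)]
    [IsContMDiffRiemannianBundle 𝓘(ℝ, FQ) ∞ FQ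
      (fun q : KahlerQuot.OrbitSpace (fun x : N ↦ μ x) ↦ TangentSpace 𝓘(ℝ, FQ) q)]
    (hQN : KahlerQuot.IsKahlerQuotient (E := EN) (fun x : N ↦ μ x) (EZ := FZ) (EQ := FQ)) :
    -- the natural map is an isometric embedding onto a totally geodesic submanifold
    ContMDiff 𝓘(ℝ, FQ) 𝓘(ℝ, EQ) ∞ (KahlerQuot.OrbitSpace.incl N μ) ∧
      IsEmbedding (KahlerQuot.OrbitSpace.incl N μ) ∧
      KahlerQuot.IsIsometric (E := EQ) (F := FQ) (KahlerQuot.OrbitSpace.incl N μ) ∧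
      KahlerQuot.IsTotallyGeodesic (E := EQ) (F := FQ) (KahlerQuot.OrbitSpace.incl N μ) := by
  have hinv := hμ.map_smul hJ.inner_apply_self
  have hc (z : Circle) : Continuous fun x : M ↦ z • x :=
    ((contMDiff_const (I := 𝓘(ℝ, E)) (I' := 𝓡 1) (n := ∞) (c := z)).smul
      (contMDiff_id (I := 𝓘(ℝ, E)))).continuous
  exact ⟨KahlerQuot.contMDiff_orbitSpace_incl hinv hN hQ hQN,
    KahlerQuot.OrbitSpace.isEmbedding_incl N hinv hc,
    KahlerQuot.isIsometric_orbitSpace_incl hinv hN hQ hQN,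
    KahlerQuot.isTotallyGeodesic_orbitSpace_incl hfree hJ hμ hN hQ hQN⟩
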